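/- Let $\varphi:[0,1]\to[0,\infty)$ be a nondecreasing concave function with $\varphi(0)=0$, $\varphi(1)>0$ and $\lim_{t\to0+}\varphi(t)=0$. Let $\varLambda_\varphi$ be the Lorentz space of all (classes modulo a.e. equality of) Lebesgue measurable functions $x:[0,1]\to\mathbb R$ with $$\|x\|_{\varLambda_\varphi}:=\int_0^1 x^*(t)\,d\varphi(t)<\infty,\qquad x^*(t):=\inf\{s\ge 0:\ m\{u\in[0,1]:|x(u)|>s\}\le t\},$$ where $m$ is Lebesgue measure. For $f$ on $[0,1]$ put $V_0f(t)=f(2t)$ for $0\le t\le\frac12$, $V_1f(t)=f(2t-1)$ for $\frac12\le t\le1$, both functions being $0$ elsewhere on $[0,1]$; let $\mathbb A=\bigcup_{k\ge0}\{0,1\}^k$ and, for $\alpha=(\alpha_1,\dots,\alpha_k)\in\mathbb A$, put $|\alpha|=k$ and $V^\alpha f=V_{\alpha_1}\cdots V_{\alpha_k}f$. The system $\{V^\alpha f\}_{\alpha\in\mathbb A}$ of dyadic dilations and translations of $f\in\varLambda_\varphi$ is called an absolutely representing system in $\varLambda_\varphi$ if there is a constant $C>0$ such that for every $x\in\varLambda_\varphi$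 there are real coefficients $\{\xi_\alpha\}_{\alpha\in\mathbb A}$ with $$x=\sum_{\alpha\in\mathbb A}\xi_\alpha V^\alpha f\ \text{ (unconditionally in }\varLambda_\varphi)\quad\text{and}\quad \sum_{k=0}^\infty\Big\|\sum_{|\alpha|=k}\xi_\alpha V^\alpha f\Big\|_{\varLambda_\varphi}\le C\|x\|_{\varLambda_\varphi}.$$ Then the following conditions are equivalent: (i) for every $f\in\varLambda_\varphi$ with $\int_0^1 f(t)\,dt\ne0$, the system $\{V^\alpha f\}_{\alpha\in\mathbb A}$ is an absolutely representing system in $\varLambda_\varphi$; (ii) $\varphi$ is submultiplicative: there is $C>0$ such that $\varphi(st)\le C\varphi(s)\varphi(t)$ for all $0\le s,t\le1$. -/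

import Mathlib

open Set MeasureTheory Filter Topology
open scoped ENNReal

noncomputable section

/-- The extension of `φ : [0,1] → ℝ` (given as a function on `ℝ` that is monotone on `[0,1]`) to all
of `ℝ`, constant to the left of `0` and to the right of `1`, is monotone. -/
theorem clampExtend_monotone {φ : ℝ → ℝ} (hφ : MonotoneOn φ (Icc 0 1)) :
    Monotone (fun t : ℝ => φ (max 0 (min 1 t))) := by
  intro s t hst
  refine hφ ⟨le_max_left _ _, max_le zero_le_one (min_le_left _ _)⟩
    ⟨le_max_left _ _, max_le zero_le_one (min_le_left _ _)⟩ ?_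
  exact max_le_max le_rfl (min_le_min le_rfl hst)

/-- The Lebesgue–Stieltjes measure `dφ` of a function `φ` increasing on `[0,1]`
(a jump of `φ` at `0` is charged as an atom at `0`). -/
def lorentzMeasure {φ : ℝ → ℝ} (hφ : MonotoneOn φ (Icc 0 1)) : Measure ℝ :=
  (clampExtend_monotone hφ).stieltjesFunction.measure

/-- The decreasing rearrangement `x*(t) = inf {s ≥ 0 : m {u ∈ [0,1] : |x u| > s} ≤ t}` of a function
`x` on `[0,1]`, with values in `[0, ∞]`. Only the values of `x` on `[0,1]` matter. -/
def decreasingRearrangement (x : ℝ → ℝ) (t : ℝ) : ℝ≥0∞ :=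
  sInf {s : ℝ≥0∞ | volume {u : ℝ | u ∈ Icc (0 : ℝ) 1 ∧ s < ‖x u‖ₑ} ≤ ENNReal.ofReal t}

/-- The norm `∫₀¹ x*(t) dφ(t)` of the Lorentz space `Λ_φ`, with value `∞` outside the space. -/
def lorentzNorm {φ : ℝ → ℝ} (hφ : MonotoneOn φ (Icc 0 1)) (x : ℝ → ℝ) : ℝ≥0∞ :=
  ∫⁻ t in Icc (0 : ℝ) 1, decreasingRearrangement x t ∂(lorentzMeasure hφ)

/-- `x` (a representative of its class modulo equality a.e. on `[0,1]`) belongs to `Λ_φ`. -/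
def MemLorentz {φ : ℝ → ℝ} (hφ : MonotoneOn φ (Icc 0 1)) (x : ℝ → ℝ) : Prop :=
  AEMeasurable x (volume.restrict (Icc (0 : ℝ) 1)) ∧ lorentzNorm hφ x < ∞

/-- The operators `V₀ f (t) = f (2 t)` on `[0,1/2]`, `V₁ f (t) = f (2 t - 1)` on `[1/2,1]`,
both `0` elsewhere. -/
def dyadicOp (i : Fin 2) (f : ℝ → ℝ) : ℝ → ℝ :=
  if i = 0 then (Icc (0 : ℝ) (1 / 2)).indicator (fun t => f (2 * t))
  else (Icc (1 / 2 : ℝ) 1).indicator (fun t => f (2 * t - 1))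

/-- The set `𝔸 = ⋃ₖ {0,1}ᵏ` of finite binary multi-indices; `α.1` is the length of `α`. -/
abbrev DyadicIndex : Type := Σ k : ℕ, (Fin k → Fin 2)

/-- `V^α f = V_{α₁} (V_{α₂} (⋯ (V_{αₖ} f)))`. -/
def dyadicV (α : DyadicIndex) (f : ℝ → ℝ) : ℝ → ℝ :=
  (List.ofFn α.2).foldr dyadicOp f

/-- The system `{V^α f}` of dyadic dilations and translations of `f` is an absolutely representing
system in `Λ_φ` (with some constant `C > 0`): each `x ∈ Λ_φ` has coefficients `ξ` such that
`x = ∑_{α ∈ 𝔸} ξ_α V^α f`, with (unconditional) convergence in `Λ_φ`, and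
`∑ₖ ‖∑_{|α| = k} ξ_α V^α f‖ ≤ C ‖x‖`. -/
def IsAbsolutelyRepresentingSystem {φ : ℝ → ℝ} (hφ : MonotoneOn φ (Icc 0 1)) (f : ℝ → ℝ) : Prop :=
  ∃ C : ℝ, 0 < C ∧ ∀ x : ℝ → ℝ, MemLorentz hφ x → ∃ ξ : DyadicIndex → ℝ,
    Tendsto (fun F : Finset DyadicIndex =>
        lorentzNorm hφ (fun t => x t - ∑ α ∈ F, ξ α * dyadicV α f t)) atTop (𝓝 0) ∧
      ∑' k : ℕ, lorentzNorm hφ (fun t => ∑ a : Fin k → Fin 2, ξ ⟨k, a⟩ * dyadicV ⟨k, a⟩ f t)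
        ≤ ENNReal.ofReal C * lorentzNorm hφ x

/-- `φ` is submultiplicative on `[0,1]` up to a constant. -/
def IsSubmultiplicative (φ : ℝ → ℝ) : Prop :=
  ∃ C : ℝ, 0 < C ∧ ∀ s ∈ Icc (0 : ℝ) 1, ∀ t ∈ Icc (0 : ℝ) 1, φ (s * t) ≤ C * φ s * φ t

end

open Set MeasureTheory Filter Topology
open scoped ENNReal

noncomputable section

/-! Everything is read through the layer-cake formula `‖x‖ = ∫₀^∞ φ(m{|x| > s}) ds`. A level
`∑_{|α|=k} ξ_α V^α f` is the dyadic step function with values `ξ_α`, multiplied by `f(2ᵏ·)`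
(argument mod 1). It is equimeasurable with the tensor product `ξ ⊗ f`: its distribution function is
the average over `α` of those of `ξ_α f`. The question is thus whether tensor products are bounded.

Submultiplicativity suffices. If `ξ` is the indicator of a set of measure `p`, the distribution
function of `ξ ⊗ f` is `p · m{|f| > s}`, so `φ(st) ≤ C φ(s) φ(t)` gives `‖ξ ⊗ f‖ ≤ C ‖ξ‖ ‖f‖`.
Peeling off horizontal layers extends this to every step function (`lorentzNorm_dyadicSum_le`). If
`∫ f ≠ 0`, the weak law of large numbers for the doubling map makes suitable multiples of finite
sums of the `f(2ᵐ·)` converge to `1` in norm (`exists_average_close_to_one`). Multiplying such a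
sum, shifted to level `k`, by a step function close to `x` removes half of `‖x‖`, at a cost
proportional to `‖x‖` and using only levels as high as desired (`exists_window`). Iteration produces
a series whose level norms are dominated by a geometric series, and this also gives unconditional
convergence.

Submultiplicativity is necessary. Let `f` vanish on `[0,1/2)` and expand the indicator of `[0,r)`,
`r = 2⁻ᵃ`. Levels below `a` vanish on `[0,r)`. On a level `y_j` with `j ≥ a`, Jensen's inequality
for `φ` gives `∫_{[0,r)} |y_j| · Q ≤ r ‖f‖₁ ‖y_j‖`, where `Q = ∫₀^∞ φ(r · m{|f| > s}) ds` is the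
norm of `1_{[0,r)} ⊗ f`. Summation over `j` yields `Q ≤ C_f φ(r)` with `C_f` independent of `r`
(`exists_lintegral_le_of_representing`). If submultiplicativity fails, a single `f` assembled from
indicators of sets of measure `t_i`, with `φ(r_i t_i) > 4ⁱ φ(r_i) φ(t_i)`, violates this bound. -/

/-- The standing assumptions on the generating function of a Lorentz space. -/
structure IsLorentzWeight (φ : ℝ → ℝ) : Prop where
  mono : MonotoneOn φ (Icc 0 1)
  conc : ConcaveOn ℝ (Icc 0 1) φ
  zero : φ 0 = 0
  pos : 0 < φ 1
  lim : Tendsto φ (𝓝[>] 0) (𝓝 0)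

/-! ### Elementary consequences of concavity. -/

namespace IsLorentzWeight

variable {φ : ℝ → ℝ}

theorem nonneg (h : IsLorentzWeight φ) {t : ℝ} (ht : t ∈ Icc (0 : ℝ) 1) : 0 ≤ φ t := by
  rw [← h.zero]
  exact h.mono ⟨le_rfl, zero_le_one⟩ ht ht.1

/-- Concavity along a segment starting at the origin. -/
theorem mul_le (h : IsLorentzWeight φ) {c t : ℝ} (hc : c ∈ Icc (0 : ℝ) 1)
    (ht : t ∈ Icc (0 : ℝ) 1) : c * φ t ≤ φ (c * t) := by
  have := h.conc.2 ht (⟨le_rfl, zero_le_one⟩ : (0 : ℝ) ∈ Icc (0 : ℝ) 1) hc.1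
    (sub_nonneg.2 hc.2) (by ring)
  simpa [h.zero] using this

theorem pos_of_pos (h : IsLorentzWeight φ) {t : ℝ} (h0 : 0 < t) (h1 : t ≤ 1) : 0 < φ t := by
  have := h.mul_le ⟨h0.le, h1⟩ (⟨zero_le_one, le_rfl⟩ : (1 : ℝ) ∈ Icc (0 : ℝ) 1)
  rw [mul_one] at this
  exact (mul_pos h0 h.pos).trans_le this

/-- A concave function has smaller sums at the endpoints of an interval than at inner points with
the same sum. -/
theorem add_le_add_of_sum_eq (h : IsLorentzWeight φ) {p q r s : ℝ} (hq : 0 ≤ q) (hs : s ≤ 1)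
    (hqp : q ≤ p) (hps : p ≤ s) (hsum : p + r = q + s) : φ q + φ s ≤ φ p + φ r := by
  rcases eq_or_lt_of_le (hqp.trans hps) with he | hlt
  · have h1 : p = q := le_antisymm (by linarith) hqp
    have h2 : r = s := by linarith
    rw [h1, h2]
  have hd : 0 < s - q := by linarith
  set a := (s - p) / (s - q) with ha
  have ha0 : 0 ≤ a := div_nonneg (by linarith) hd.le
  have ha1 : 0 ≤ 1 - a := by
    rw [sub_nonneg, ha, div_le_one hd]; linarith
  have hmul : a * (s - q) = s - p := div_mul_cancel₀ _ hd.ne'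
  have hqm : q ∈ Icc (0 : ℝ) 1 := ⟨hq, by linarith⟩
  have hsm : s ∈ Icc (0 : ℝ) 1 := ⟨by linarith, hs⟩
  have e1 := h.conc.2 hqm hsm ha0 ha1 (by ring)
  have e2 := h.conc.2 hsm hqm ha0 ha1 (by ring)
  simp only [smul_eq_mul] at e1 e2
  rw [show a * q + (1 - a) * s = p by linarith] at e1
  rw [show a * s + (1 - a) * q = r by linarith] at e2
  linarith

theorem add_le (h : IsLorentzWeight φ) {p q : ℝ} (hp : 0 ≤ p) (hq : 0 ≤ q) (hpq : p + q ≤ 1) :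
    φ (p + q) ≤ φ p + φ q := by
  have := h.add_le_add_of_sum_eq (p := p) (r := q) le_rfl hpq hp (by linarith) (by ring)
  rwa [h.zero, zero_add] at this

theorem exists_delta (h : IsLorentzWeight φ) {ε : ℝ} (hε : 0 < ε) :
    ∃ δ, 0 < δ ∧ δ ≤ 1 ∧ ∀ t, 0 ≤ t → t ≤ δ → φ t < ε := by
  have := h.lim.eventually (gt_mem_nhds hε)
  rw [eventually_nhdsWithin_iff, Metric.eventually_nhds_iff] at this
  obtain ⟨δ, hδ, hh⟩ := this
  refine ⟨min (δ / 2) 1, by positivity, min_le_right _ _, fun t h0 ht => ?_⟩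
  rcases h0.eq_or_lt with rfl | h0
  · rwa [h.zero]
  refine hh ?_ h0
  rw [Real.dist_eq, sub_zero, abs_of_pos h0]
  linarith [ht.trans (min_le_left _ _)]

/-- Subadditivity bounds an increment of `φ` by the value of `φ` at the step, so smallness near `0`
propagates to all of `[0,1]`. -/
theorem continuousOn (h : IsLorentzWeight φ) : ContinuousOn φ (Icc 0 1) := by
  rw [Metric.continuousOn_iff]
  intro v hv ε hε
  obtain ⟨δ, hδ, hδ1, hh⟩ := h.exists_delta hε
  refine ⟨δ, hδ, fun u hu huv => ?_⟩
  rw [Real.dist_eq] at huv ⊢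
  have key : ∀ a ∈ Icc (0 : ℝ) 1, ∀ b ∈ Icc (0 : ℝ) 1, a ≤ b → φ b ≤ φ a + φ |b - a| := by
    intro a ha b hb hab
    rw [abs_of_nonneg (sub_nonneg.2 hab)]
    have := h.add_le ha.1 (sub_nonneg.2 hab) (by linarith [hb.2])
    rwa [add_sub_cancel] at this
  have hsmall := hh |u - v| (abs_nonneg _) huv.le
  rcases le_total u v with huv' | huv'
  · have h1 := h.mono hu hv huv'
    have h2 := key u hu v hv huv'
    rw [abs_sub_comm v u] at h2
    rw [abs_lt]; constructor <;> linarith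
  · have h1 := h.mono hv hu huv'
    have h2 := key v hv u hu huv'
    rw [abs_lt]; constructor <;> linarith

/-- Continuity removes the one-sided limits from the Stieltjes construction, and `φ 0 = 0` with the
limit at `0` excludes an atom at the origin. -/
theorem lorentzMeasure_Ico (h : IsLorentzWeight φ) {r : ℝ} (hr : r ∈ Icc (0 : ℝ) 1) :
    lorentzMeasure h.mono (Ico 0 r) = ENNReal.ofReal (φ r) := by
  have hcont : Continuous (fun t : ℝ => φ (max 0 (min 1 t))) :=
    h.continuousOn.comp_continuous (by fun_prop) fun t =>
      ⟨le_max_left _ _, max_le zero_le_one (min_le_left _ _)⟩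
  have heq : ∀ t, (clampExtend_monotone h.mono).stieltjesFunction t = φ (max 0 (min 1 t)) := by
    intro t
    rw [Monotone.stieltjesFunction_eq]
    exact (hcont.continuousAt.continuousWithinAt).rightLim_eq
  have heq' : ((clampExtend_monotone h.mono).stieltjesFunction : ℝ → ℝ)
      = fun t => φ (max 0 (min 1 t)) := funext heq
  unfold lorentzMeasure
  rw [StieltjesFunction.measure_Ico, heq', (hcont.continuousAt.continuousWithinAt).leftLim_eq,
    (hcont.continuousAt.continuousWithinAt).leftLim_eq]
  simp [h.zero, hr.1, hr.2]

end IsLorentzWeight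

/-! ### Distribution functions and the layer-cake formula. -/

/-- Lebesgue measure on the unit interval. -/
abbrev unitMeasure : Measure ℝ := volume.restrict (Icc (0 : ℝ) 1)

instance : IsProbabilityMeasure unitMeasure := ⟨by simp [unitMeasure]⟩

/-- The distribution function of `|x|` with respect to Lebesgue measure on `[0,1]`. -/
def distribution (x : ℝ → ℝ) (s : ℝ) : ℝ := unitMeasure.real {u | s < |x u|}

theorem distribution_mem (x : ℝ → ℝ) (s : ℝ) : distribution x s ∈ Icc (0 : ℝ) 1 :=
  ⟨measureReal_nonneg, measureReal_le_one⟩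

theorem distribution_antitone (x : ℝ → ℝ) : Antitone (distribution x) := fun _ _ hst =>
  measureReal_mono fun _ hu => hst.trans_lt hu

theorem ofReal_distribution (x : ℝ → ℝ) (s : ℝ) :
    ENNReal.ofReal (distribution x s) = unitMeasure {u | s < |x u|} :=
  ofReal_measureReal

/-- The rearrangement is the generalized inverse of the distribution function. With strict
inequalities the equivalence has no exceptional points, which is what the exchange of integrals in
`lorentzNorm_eq` needs. -/
theorem lt_decreasingRearrangement_iff (x : ℝ → ℝ) {s t : ℝ} (hs : 0 ≤ s) :
    ENNReal.ofReal s < decreasingRearrangement x t ↔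
      ENNReal.ofReal t < unitMeasure {u | s < |x u|} := by
  have hset : ∀ r : ℝ, 0 ≤ r → volume {u : ℝ | u ∈ Icc (0 : ℝ) 1 ∧ ENNReal.ofReal r < ‖x u‖ₑ}
      = unitMeasure {u | r < |x u|} := by
    intro r hr
    rw [unitMeasure, Measure.restrict_apply' measurableSet_Icc]
    congr 1
    ext u
    simp only [mem_ofPred_eq, mem_inter_iff, ← ofReal_norm, Real.norm_eq_abs,
      ENNReal.ofReal_lt_ofReal_iff_of_nonneg hr]
    exact and_comm
  unfold decreasingRearrangement
  constructor
  · intro h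
    by_contra hcon
    refine (h.trans_le (sInf_le ?_)).false
    rw [mem_ofPred_eq, hset s hs]
    exact not_lt.1 hcon
  · intro h
    -- Continuity from below: some level strictly above `s` still has measure greater than `t`,
    -- which keeps the infimum strictly above `s`.
    have hU : {u | s < |x u|} = ⋃ n : ℕ, {u | s + 1 / ((n : ℝ) + 1) < |x u|} := by
      ext u
      simp only [mem_ofPred_eq, mem_iUnion]
      constructor
      · intro hu
        obtain ⟨n, hn⟩ := exists_nat_one_div_lt (sub_pos.2 hu)
        exact ⟨n, by linarith⟩
      · rintro ⟨n, hn⟩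
        have : (0 : ℝ) < 1 / ((n : ℝ) + 1) := by positivity
        linarith
    have hmon : Monotone fun n : ℕ => {u | s + 1 / ((n : ℝ) + 1) < |x u|} := by
      intro m n hmn u hu
      simp only [mem_ofPred_eq] at hu ⊢
      have : 1 / ((n : ℝ) + 1) ≤ 1 / ((m : ℝ) + 1) := by gcongr
      linarith
    rw [hU, hmon.measure_iUnion, lt_iSup_iff] at h
    obtain ⟨n, hn⟩ := h
    have hp : (0 : ℝ) < 1 / ((n : ℝ) + 1) := by positivity
    refine lt_of_lt_of_le ((ENNReal.ofReal_lt_ofReal_iff (by positivity)).2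
      (lt_add_of_pos_right s hp)) (le_sInf fun r hr => ?_)
    by_contra hcon
    rw [mem_ofPred_eq] at hr
    refine (hn.trans_le (le_trans ?_ hr)).false
    rw [← hset _ (by positivity)]
    exact measure_mono fun u hu => ⟨hu.1, (not_le.1 hcon).trans hu.2⟩

theorem decreasingRearrangement_eq_lintegral (x : ℝ → ℝ) (t : ℝ) :
    decreasingRearrangement x t =
      ∫⁻ s in Ioi (0 : ℝ), {s | ENNReal.ofReal s < decreasingRearrangement x t}.indicator 1 s := by
  rw [lintegral_indicator_one (measurableSet_lt ENNReal.measurable_ofReal measurable_const),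
    Measure.restrict_apply' measurableSet_Ioi]
  rcases eq_or_ne (decreasingRearrangement x t) ∞ with h | h
  · simp [h]
  · have : {s | ENNReal.ofReal s < decreasingRearrangement x t} ∩ Ioi 0
        = Ioo 0 (decreasingRearrangement x t).toReal := by
      ext s
      simp only [mem_inter_iff, mem_ofPred_eq, mem_Ioi, mem_Ioo]
      constructor
      · rintro ⟨h1, h2⟩
        exact ⟨h2, (ENNReal.ofReal_lt_iff_lt_toReal h2.le h).1 h1⟩
      · rintro ⟨h1, h2⟩
        exact ⟨(ENNReal.ofReal_lt_iff_lt_toReal h1.le h).2 h2, h1⟩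
    rw [this, Real.volume_Ioo, sub_zero, ENNReal.ofReal_toReal h]

/-- Layer-cake formula for the Lorentz norm. -/
theorem lorentzNorm_eq {φ : ℝ → ℝ} (h : IsLorentzWeight φ) (x : ℝ → ℝ) :
    lorentzNorm h.mono x = ∫⁻ s in Ioi (0 : ℝ), ENNReal.ofReal (φ (distribution x s)) := by
  have : SFinite (lorentzMeasure h.mono) := by unfold lorentzMeasure; infer_instance
  have hanti : Measurable (distribution x) := (distribution_antitone x).measurable
  have hms : MeasurableSet {p : ℝ × ℝ | p.1 < distribution x p.2} :=
    measurableSet_lt measurable_fst (hanti.comp measurable_snd)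
  have hiff : ∀ t ∈ Icc (0 : ℝ) 1, ∀ s ∈ Ioi (0 : ℝ),
      {s | ENNReal.ofReal s < decreasingRearrangement x t}.indicator (1 : ℝ → ℝ≥0∞) s
      = {p : ℝ × ℝ | p.1 < distribution x p.2}.indicator 1 (t, s) := by
    intro t ht s hs
    simp only [indicator, mem_ofPred_eq, lt_decreasingRearrangement_iff x (le_of_lt hs),
      ← ofReal_distribution, ENNReal.ofReal_lt_ofReal_iff_of_nonneg ht.1]
    rfl
  unfold lorentzNorm
  calc ∫⁻ t in Icc (0 : ℝ) 1, decreasingRearrangement x t ∂(lorentzMeasure h.mono)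
      = ∫⁻ t in Icc (0 : ℝ) 1, ∫⁻ s in Ioi (0 : ℝ),
          {p : ℝ × ℝ | p.1 < distribution x p.2}.indicator 1 (t, s) ∂volume
          ∂(lorentzMeasure h.mono) := by
        refine setLIntegral_congr_fun measurableSet_Icc fun t ht => ?_
        rw [decreasingRearrangement_eq_lintegral]
        exact setLIntegral_congr_fun measurableSet_Ioi fun s hs => hiff t ht s hs
    _ = ∫⁻ s in Ioi (0 : ℝ), ∫⁻ t in Icc (0 : ℝ) 1,
          {p : ℝ × ℝ | p.1 < distribution x p.2}.indicator 1 (t, s) ∂(lorentzMeasure h.mono) :=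
        lintegral_lintegral_swap ((measurable_one.indicator hms).aemeasurable)
    _ = _ := by
        refine setLIntegral_congr_fun measurableSet_Ioi fun s _ => ?_
        have hd := distribution_mem x s
        have : (fun t => {p : ℝ × ℝ | p.1 < distribution x p.2}.indicator (1 : ℝ × ℝ → ℝ≥0∞) (t, s))
            = (Iio (distribution x s)).indicator 1 := by
          ext t; simp [indicator]
        simp only [this]
        rw [lintegral_indicator_one measurableSet_Iio, Measure.restrict_apply measurableSet_Iio,
          ← h.lorentzMeasure_Ico hd]
        congr 1
        ext t
        simp only [mem_inter_iff, mem_Iio, mem_Icc, mem_Ico]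
        constructor
        · rintro ⟨h1, h2, _⟩; exact ⟨h2, h1⟩
        · rintro ⟨h1, h2⟩; exact ⟨h2, h1, h2.le.trans hd.2⟩

/-! ### Subadditivity of Choquet integrals of submodular set functions. -/

section Choquet

variable {Ω : Type*} [MeasurableSpace Ω] {v : Set Ω → ℝ≥0∞}

/-- Adding the indicator of a set to a natural-valued function raises the Choquet sum of a
submodular set function by at most the value of the set. -/
theorem tsum_capacity_add_indicator_le
    (hsub : ∀ A B, MeasurableSet A → MeasurableSet B → v (A ∪ B) + v (A ∩ B) ≤ v A + v B)
    {f : Ω → ℕ} (hf : Measurable f) {A : Set Ω} (hA : MeasurableSet A) :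
    ∑' k : ℕ, v {t | k < f t + A.indicator 1 t} ≤ (∑' k : ℕ, v {t | k < f t}) + v A := by
  have hm : ∀ k : ℕ, MeasurableSet {t | k < f t} := fun k => measurableSet_lt measurable_const hf
  -- `B n` is the part of `A` still carried upwards after the levels below `n` are treated. The new
  -- level set is `{n < f} ∪ B n` and the next carry is `{n < f} ∩ B n`, so each level is one
  -- application of submodularity and the inequalities telescope.
  let B : ℕ → Set Ω := fun n => {t | t ∈ A ∧ ∀ k < n, k < f t}
  have hB0 : B 0 = A := by ext t; simp [B]
  have hBm : ∀ n, MeasurableSet (B n) := by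
    intro n
    have : B n = A ∩ ⋂ k ∈ Finset.range n, {t | k < f t} := by ext t; simp [B]
    rw [this]
    exact hA.inter (Finset.measurableSet_biInter _ fun k _ => hm k)
  have hU : ∀ n, {t | n < f t + A.indicator 1 t} = {t | n < f t} ∪ B n := by
    intro n
    ext t
    by_cases ht : t ∈ A
    · simp only [mem_ofPred_eq, mem_union, ht, indicator_of_mem, Pi.one_apply, true_and, B]
      constructor
      · intro h
        right; intro k hk; omega
      · rintro (h | h)
        · omega
        · rcases Nat.eq_zero_or_pos n with rfl | hn
          · omega
          · have := h (n - 1) (by omega); omega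
    · simp [ht, B]
  have hI : ∀ n, B (n + 1) = {t | n < f t} ∩ B n := by
    intro n
    ext t
    simp only [mem_ofPred_eq, mem_inter_iff, B]
    constructor
    · rintro ⟨h1, h2⟩
      exact ⟨h2 n (by omega), h1, fun k hk => h2 k (by omega)⟩
    · rintro ⟨h1, h2, h3⟩
      refine ⟨h2, fun k hk => by omega⟩
  have hpart : ∀ n, (∑ k ∈ Finset.range n, v {t | k < f t + A.indicator 1 t}) + v (B n)
      ≤ (∑ k ∈ Finset.range n, v {t | k < f t}) + v A := by
    intro n
    induction n with
    | zero => simp [hB0]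
    | succ n ih =>
      rw [Finset.sum_range_succ, Finset.sum_range_succ, hU n, hI n, add_assoc]
      calc _ ≤ (∑ k ∈ Finset.range n, v {t | k < f t + A.indicator 1 t})
            + (v {t | n < f t} + v (B n)) := add_le_add_right (hsub _ _ (hm n) (hBm n)) _
        _ = ((∑ k ∈ Finset.range n, v {t | k < f t + A.indicator 1 t}) + v (B n))
            + v {t | n < f t} := by ring
        _ ≤ _ := by
            refine (add_le_add_left ih _).trans (le_of_eq ?_)
            ring
  refine ENNReal.tsum_le_of_sum_range_le fun n => ?_
  refine le_self_add.trans ((hpart n).trans ?_)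
  gcongr
  exact ENNReal.sum_le_tsum _

/-- A natural-valued `g` is the sum of the indicators of its level sets `{n < g}`, which are added
to `f` one at a time. Truncating `g` at `n` does not change the levels below `n`, so partial sums
suffice. -/
theorem tsum_capacity_add_le
    (hsub : ∀ A B, MeasurableSet A → MeasurableSet B → v (A ∪ B) + v (A ∩ B) ≤ v A + v B)
    {f g : Ω → ℕ} (hf : Measurable f) (hg : Measurable g) :
    ∑' k : ℕ, v {t | k < f t + g t} ≤ (∑' k : ℕ, v {t | k < f t}) + ∑' k : ℕ, v {t | k < g t} := by
  have key : ∀ n : ℕ, ∑' k : ℕ, v {t | k < f t + min (g t) n}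
      ≤ (∑' k : ℕ, v {t | k < f t}) + ∑ k ∈ Finset.range n, v {t | k < g t} := by
    intro n
    induction n with
    | zero => simp
    | succ n ih =>
      have hA : MeasurableSet {t | n < g t} := measurableSet_lt measurable_const hg
      have heq : ∀ t, f t + min (g t) (n + 1)
          = (f t + min (g t) n) + {t | n < g t}.indicator 1 t := by
        intro t
        by_cases ht : n < g t
        · rw [indicator_of_mem (by exact ht)]; simp only [Pi.one_apply]; omega
        · rw [indicator_of_notMem (by exact ht)]; omega
      simp only [heq]
      refine (tsum_capacity_add_indicator_le hsub (hf.add (hg.min measurable_const)) hA).trans ?_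
      rw [Finset.sum_range_succ, ← add_assoc]
      exact add_le_add_left ih _
  refine ENNReal.tsum_le_of_sum_range_le fun n => ?_
  calc ∑ k ∈ Finset.range n, v {t | k < f t + g t}
      = ∑ k ∈ Finset.range n, v {t | k < f t + min (g t) n} := by
        refine Finset.sum_congr rfl fun k hk => ?_
        have := Finset.mem_range.1 hk
        congr 1; ext t; simp only [mem_ofPred_eq]; omega
    _ ≤ _ := (ENNReal.sum_le_tsum _).trans ((key n).trans (by gcongr; exact ENNReal.sum_le_tsum _))

theorem lintegral_comp_floor_div (a : ℕ → ℝ≥0∞) {ε : ℝ} (hε : 0 < ε) :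
    ∫⁻ s in Ioi (0 : ℝ), a ⌊s / ε⌋₊ = ∑' k, ENNReal.ofReal ε * a k := by
  have hfl : ∀ s : ℝ, 0 ≤ s → ∀ k : ℕ, s ∈ Ico (k * ε) ((k + 1) * ε) ↔ ⌊s / ε⌋₊ = k := by
    intro s hs k
    rw [Nat.floor_eq_iff (div_nonneg hs hε.le), le_div_iff₀ hε, div_lt_iff₀ hε, mem_Ico]
  have hpt : ∀ s ∈ Ici (0 : ℝ), a ⌊s / ε⌋₊
      = ∑' k : ℕ, (Ico (k * ε) ((k + 1) * ε)).indicator (fun _ => a k) s := by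
    intro s hs
    rw [tsum_eq_single ⌊s / ε⌋₊, indicator_of_mem ((hfl s hs _).2 rfl)]
    intro k hk
    exact indicator_of_notMem (fun h => hk ((hfl s hs k).1 h).symm) _
  rw [← setLIntegral_congr Ioi_ae_eq_Ici.symm, setLIntegral_congr_fun measurableSet_Ici hpt,
    lintegral_tsum fun k => (measurable_const.indicator measurableSet_Ico).aemeasurable]
  refine tsum_congr fun k => ?_
  rw [lintegral_indicator measurableSet_Ico, setLIntegral_const,
    Measure.restrict_apply measurableSet_Ico, inter_eq_left.2, Real.volume_Ico, mul_comm]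
  · congr 2; ring
  · intro s hs
    exact le_trans (by positivity) hs.1

theorem lintegral_Ioi_comp_add (G : ℝ → ℝ≥0∞) (c : ℝ) :
    ∫⁻ s in Ioi (0 : ℝ), G (s + c) = ∫⁻ s in Ioi c, G s := by
  have hmp := measurePreserving_add_right (volume : Measure ℝ) c
  rw [← hmp.setLIntegral_comp_preimage_emb (measurableEmbedding_addRight _) G (Ioi c)]
  congr 2
  ext s
  simp

/-- Subadditivity of the Choquet integral of a finite monotone submodular set function. -/
theorem lintegral_capacity_add_le (hmono : ∀ A B, A ⊆ B → v A ≤ v B) (hfin : v univ ≠ ∞)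
    (hsub : ∀ A B, MeasurableSet A → MeasurableSet B → v (A ∪ B) + v (A ∩ B) ≤ v A + v B)
    {x y : Ω → ℝ} (hx : Measurable x) (hy : Measurable y) (hx0 : ∀ t, 0 ≤ x t)
    (hy0 : ∀ t, 0 ≤ y t) :
    ∫⁻ s in Ioi (0 : ℝ), v {t | s < x t + y t}
      ≤ (∫⁻ s in Ioi (0 : ℝ), v {t | s < x t}) + ∫⁻ s in Ioi (0 : ℝ), v {t | s < y t} := by
  have hdisc : ∀ z : Ω → ℝ, (∀ t, 0 ≤ z t) → ∀ ε : ℝ, 0 < ε →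
      ∑' k, ENNReal.ofReal ε * v {t | k < ⌊z t / ε⌋₊} ≤ ∫⁻ s in Ioi (0 : ℝ), v {t | s < z t} := by
    intro z hz ε hε
    rw [← lintegral_comp_floor_div (fun k => v {t | k < ⌊z t / ε⌋₊}) hε]
    refine setLIntegral_mono' measurableSet_Ioi fun s hs => hmono _ _ fun t ht => ?_
    simp only [mem_ofPred_eq] at ht ⊢
    have h1 : s / ε < ⌊s / ε⌋₊ + 1 := Nat.lt_floor_add_one _
    have h2 : ((⌊s / ε⌋₊ + 1 : ℕ) : ℝ) ≤ z t / ε :=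
      (Nat.le_floor_iff (div_nonneg (hz t) hε.le)).1 ht
    push_cast at h2
    exact (div_lt_div_iff_of_pos_right hε).1 (h1.trans_le h2)
  -- Rounding both functions down to multiples of `ε` lowers their sum by less than `2ε`; the
  -- discrete inequality therefore controls all levels above `2ε`.
  have hmain : ∀ ε : ℝ, 0 < ε → ∫⁻ s in Ioi (2 * ε), v {t | s < x t + y t}
      ≤ (∫⁻ s in Ioi (0 : ℝ), v {t | s < x t}) + ∫⁻ s in Ioi (0 : ℝ), v {t | s < y t} := by
    intro ε hε
    have hfm : ∀ z : Ω → ℝ, Measurable z → Measurable fun t => ⌊z t / ε⌋₊ := fun z hz =>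
      Nat.measurable_floor.comp (hz.div_const ε)
    calc ∫⁻ s in Ioi (2 * ε), v {t | s < x t + y t}
        = ∫⁻ s in Ioi (0 : ℝ), v {t | s + 2 * ε < x t + y t} :=
          (lintegral_Ioi_comp_add (fun s => v {t | s < x t + y t}) (2 * ε)).symm
      _ ≤ ∫⁻ s in Ioi (0 : ℝ), v {t | ⌊s / ε⌋₊ < ⌊x t / ε⌋₊ + ⌊y t / ε⌋₊} := by
          refine setLIntegral_mono' measurableSet_Ioi fun s hs => hmono _ _ fun t ht => ?_
          simp only [mem_ofPred_eq] at ht ⊢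
          have h1 : (⌊s / ε⌋₊ : ℝ) ≤ s / ε := Nat.floor_le (div_nonneg (le_of_lt hs) hε.le)
          have h2 := Nat.lt_floor_add_one (x t / ε)
          have h3 := Nat.lt_floor_add_one (y t / ε)
          have h4 : s / ε + 2 < x t / ε + y t / ε := by
            have := (div_lt_div_iff_of_pos_right hε).2 ht
            rwa [add_div, add_div, mul_div_assoc, div_self hε.ne', mul_one] at this
          have : (⌊s / ε⌋₊ : ℝ) < (⌊x t / ε⌋₊ + ⌊y t / ε⌋₊ : ℕ) := by push_cast; linarith
          exact_mod_cast this
      _ = ∑' k, ENNReal.ofReal ε * v {t | k < ⌊x t / ε⌋₊ + ⌊y t / ε⌋₊} :=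
          lintegral_comp_floor_div (fun k => v {t | k < ⌊x t / ε⌋₊ + ⌊y t / ε⌋₊}) hε
      _ ≤ (∑' k, ENNReal.ofReal ε * v {t | k < ⌊x t / ε⌋₊})
            + ∑' k, ENNReal.ofReal ε * v {t | k < ⌊y t / ε⌋₊} := by
          simp only [ENNReal.tsum_mul_left, ← mul_add]
          gcongr
          exact tsum_capacity_add_le hsub (hfm x hx) (hfm y hy)
      _ ≤ _ := add_le_add (hdisc x hx0 ε hε) (hdisc y hy0 ε hε)
  -- The neglected levels in `(0, 2ε]` contribute at most `2ε · v univ`; the `+ 1` in the choice of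
  -- `ε` covers `v univ = 0`.
  refine ENNReal.le_of_forall_pos_le_add fun η hη _ => ?_
  have hc : 0 < (v univ).toReal + 1 := by positivity
  set ε : ℝ := η / (2 * ((v univ).toReal + 1)) with hεdef
  have hε : 0 < ε := by positivity
  have hsplit : Ioi (0 : ℝ) = Ioc 0 (2 * ε) ∪ Ioi (2 * ε) :=
    (Ioc_union_Ioi_eq_Ioi (by positivity)).symm
  calc ∫⁻ s in Ioi (0 : ℝ), v {t | s < x t + y t}
      ≤ (∫⁻ s in Ioc 0 (2 * ε), v {t | s < x t + y t})
        + ∫⁻ s in Ioi (2 * ε), v {t | s < x t + y t} := by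
        rw [hsplit]; exact lintegral_union_le _ _ _
    _ ≤ η + _ := by
        refine add_le_add ?_ (hmain ε hε)
        calc ∫⁻ s in Ioc 0 (2 * ε), v {t | s < x t + y t}
            ≤ ∫⁻ s in Ioc 0 (2 * ε), v univ := lintegral_mono fun s => hmono _ _ (subset_univ _)
          _ = ENNReal.ofReal ((v univ).toReal * (2 * ε)) := by
              rw [setLIntegral_const, Real.volume_Ioc, sub_zero,
                ENNReal.ofReal_mul ENNReal.toReal_nonneg, ENNReal.ofReal_toReal hfin]
          _ ≤ η := by
              rw [← ENNReal.ofReal_coe_nnreal]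
              refine ENNReal.ofReal_le_ofReal ?_
              have : ((v univ).toReal + 1) * (2 * ε) = η := by
                rw [hεdef]; field_simp
              nlinarith
    _ = _ := add_comm _ _

end Choquet

/-! ### The Lorentz functional as a seminorm; comparison with `L¹` and with convergence in measure.
-/

namespace IsLorentzWeight

variable {φ : ℝ → ℝ} (h : IsLorentzWeight φ)
include h

theorem lorentzNorm_mono_distribution {x y : ℝ → ℝ}
    (hxy : ∀ s, 0 < s → distribution x s ≤ distribution y s) :
    lorentzNorm h.mono x ≤ lorentzNorm h.mono y := by
  rw [lorentzNorm_eq h, lorentzNorm_eq h]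
  exact setLIntegral_mono' measurableSet_Ioi fun s hs => ENNReal.ofReal_le_ofReal
    (h.mono (distribution_mem _ _) (distribution_mem _ _) (hxy s hs))

theorem lorentzNorm_mono {x y : ℝ → ℝ} (hxy : ∀ᵐ t ∂unitMeasure, |x t| ≤ |y t|) :
    lorentzNorm h.mono x ≤ lorentzNorm h.mono y := by
  refine h.lorentzNorm_mono_distribution fun s _ => ?_
  refine ENNReal.toReal_mono (measure_ne_top _ _) (measure_mono_ae ?_)
  filter_upwards [hxy] with t ht hs using lt_of_lt_of_le hs ht

theorem lorentzNorm_congr {x y : ℝ → ℝ} (hxy : ∀ᵐ t ∂unitMeasure, |x t| = |y t|) :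
    lorentzNorm h.mono x = lorentzNorm h.mono y :=
  le_antisymm (h.lorentzNorm_mono (hxy.mono fun _ ht => ht.le))
    (h.lorentzNorm_mono (hxy.mono fun _ ht => ht.ge))

/-- The norm is the Choquet integral of `A ↦ φ(m A)`. This set function is submodular because `φ` is
concave and `m(A ∪ B) + m(A ∩ B) = m A + m B`. -/
theorem lorentzNorm_add_le {x y : ℝ → ℝ} (hx : AEMeasurable x unitMeasure)
    (hy : AEMeasurable y unitMeasure) :
    lorentzNorm h.mono (fun t => x t + y t) ≤ lorentzNorm h.mono x + lorentzNorm h.mono y := by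
  set x' := fun t => |hx.mk x t|
  set y' := fun t => |hy.mk y t|
  have hx' : Measurable x' := measurable_norm.comp hx.measurable_mk
  have hy' : Measurable y' := measurable_norm.comp hy.measurable_mk
  have e1 : lorentzNorm h.mono x = lorentzNorm h.mono x' :=
    h.lorentzNorm_congr (hx.ae_eq_mk.mono fun t ht => by simp [x', ht.symm])
  have e2 : lorentzNorm h.mono y = lorentzNorm h.mono y' :=
    h.lorentzNorm_congr (hy.ae_eq_mk.mono fun t ht => by simp [y', ht.symm])
  have e3 : lorentzNorm h.mono (fun t => x t + y t)
      ≤ lorentzNorm h.mono (fun t => x' t + y' t) := by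
    refine h.lorentzNorm_mono ?_
    filter_upwards [hx.ae_eq_mk, hy.ae_eq_mk] with t h1 h2
    rw [abs_of_nonneg (show 0 ≤ x' t + y' t by positivity)]
    simpa [x', y', ← h1, ← h2] using abs_add_le (x t) (y t)
  rw [e1, e2]
  refine e3.trans ?_
  let v : Set ℝ → ℝ≥0∞ := fun A => ENNReal.ofReal (φ (unitMeasure.real A))
  have hmem : ∀ A : Set ℝ, unitMeasure.real A ∈ Icc (0 : ℝ) 1 := fun A =>
    ⟨measureReal_nonneg, measureReal_le_one⟩
  have habs : ∀ z : ℝ → ℝ, (∀ t, 0 ≤ z t) →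
      lorentzNorm h.mono z = ∫⁻ s in Ioi (0 : ℝ), v {t | s < z t} := by
    intro z hz
    rw [lorentzNorm_eq h]
    simp only [distribution, abs_of_nonneg (hz _), v]
  rw [habs x' fun t => abs_nonneg _, habs y' fun t => abs_nonneg _,
    habs _ fun t => add_nonneg (abs_nonneg _) (abs_nonneg _)]
  refine lintegral_capacity_add_le (v := v) (fun A B hAB => ENNReal.ofReal_le_ofReal
    (h.mono (hmem A) (hmem B) (measureReal_mono hAB))) ENNReal.ofReal_ne_top ?_ hx' hy'
    (fun t => abs_nonneg _) (fun t => abs_nonneg _)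
  intro A B hA hB
  simp only [v]
  rw [← ENNReal.ofReal_add (h.nonneg (hmem _)) (h.nonneg (hmem _)),
    ← ENNReal.ofReal_add (h.nonneg (hmem _)) (h.nonneg (hmem _)), add_comm]
  refine ENNReal.ofReal_le_ofReal (h.add_le_add_of_sum_eq measureReal_nonneg measureReal_le_one
    (measureReal_mono inter_subset_left) (measureReal_mono subset_union_left) ?_)
  have := measureReal_union_add_inter (μ := unitMeasure) (s := A) (t := B) hB
  linarith

theorem lorentzNorm_zero : lorentzNorm h.mono (fun _ => 0) = 0 := by
  rw [lorentzNorm_eq h, setLIntegral_congr_fun measurableSet_Ioi (g := fun _ => 0)]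
  · simp
  · intro s hs
    simp [distribution, not_lt.2 (le_of_lt (mem_Ioi.1 hs)), h.zero]

theorem lorentzNorm_sum_le {ι : Type*} (S : Finset ι) {x : ι → ℝ → ℝ}
    (hx : ∀ i ∈ S, AEMeasurable (x i) unitMeasure) :
    lorentzNorm h.mono (fun t => ∑ i ∈ S, x i t) ≤ ∑ i ∈ S, lorentzNorm h.mono (x i) := by
  classical
  induction S using Finset.induction_on with
  | empty => simp [h.lorentzNorm_zero]
  | insert i S hi ih =>
    simp only [Finset.sum_insert hi]
    refine (h.lorentzNorm_add_le (hx i (Finset.mem_insert_self _ _))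
      (Finset.aemeasurable_fun_sum _ fun j hj => hx j (Finset.mem_insert_of_mem hj))).trans ?_
    gcongr
    exact ih fun j hj => hx j (Finset.mem_insert_of_mem hj)

omit h in
/-- Change of scale in a layer-cake integral. -/
theorem lintegral_Ioi_comp_div (G : ℝ → ℝ≥0∞) {c : ℝ} (hc : 0 < c) :
    ∫⁻ s in Ioi (0 : ℝ), G (s / c) = ENNReal.ofReal c * ∫⁻ s in Ioi (0 : ℝ), G s := by
  have hm := lintegral_map_equiv (μ := volume) ((Ioi (0 : ℝ)).indicator G)
    (Homeomorph.mulRight₀ c hc.ne').symm.toMeasurableEquiv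
  have hmap : Measure.map (fun s : ℝ => s / c) volume = ENNReal.ofReal c • volume := by
    have := Real.map_volume_mul_right (a := c⁻¹) (inv_ne_zero hc.ne')
    simpa [div_eq_mul_inv, abs_of_pos hc] using this
  have e : ((Homeomorph.mulRight₀ c hc.ne').symm.toMeasurableEquiv : ℝ → ℝ) = fun s => s / c := by
    ext s; simp [div_eq_mul_inv]
  rw [e, hmap, lintegral_smul_measure, lintegral_indicator measurableSet_Ioi] at hm
  rw [smul_eq_mul] at hm
  rw [hm, ← lintegral_indicator measurableSet_Ioi]
  congr 1
  ext s
  simp only [indicator, mem_Ioi, div_pos_iff_of_pos_right hc]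

omit h in
theorem distribution_const_mul (x : ℝ → ℝ) {c : ℝ} (hc : c ≠ 0) (s : ℝ) :
    distribution (fun t => c * x t) s = distribution x (s / |c|) := by
  simp only [distribution, abs_mul, div_lt_iff₀' (abs_pos.2 hc)]

theorem lorentzNorm_const_mul (c : ℝ) (x : ℝ → ℝ) :
    lorentzNorm h.mono (fun t => c * x t) = ENNReal.ofReal |c| * lorentzNorm h.mono x := by
  rcases eq_or_ne c 0 with rfl | hc
  · simp [h.lorentzNorm_zero]
  · rw [lorentzNorm_eq h, lorentzNorm_eq h, ← lintegral_Ioi_comp_div _ (abs_pos.2 hc)]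
    simp only [distribution_const_mul x hc]

theorem lorentzNorm_neg (x : ℝ → ℝ) :
    lorentzNorm h.mono (fun t => -x t) = lorentzNorm h.mono x :=
  h.lorentzNorm_congr (Eventually.of_forall fun _ => abs_neg _)

theorem lorentzNorm_sub_le {x y : ℝ → ℝ} (hx : AEMeasurable x unitMeasure)
    (hy : AEMeasurable y unitMeasure) :
    lorentzNorm h.mono (fun t => x t - y t) ≤ lorentzNorm h.mono x + lorentzNorm h.mono y := by
  rw [← h.lorentzNorm_neg y]
  exact h.lorentzNorm_add_le hx hy.neg

omit h in
theorem lintegral_distribution {x : ℝ → ℝ} (hx : AEMeasurable x unitMeasure) :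
    ∫⁻ s in Ioi (0 : ℝ), ENNReal.ofReal (distribution x s)
      = ∫⁻ t, ENNReal.ofReal |x t| ∂unitMeasure := by
  rw [lintegral_eq_lintegral_meas_lt unitMeasure (Eventually.of_forall fun t => abs_nonneg (x t))
    (measurable_norm.comp_aemeasurable hx)]
  simp only [ofReal_distribution]

/-- The Lorentz space is contained in `L¹`. -/
theorem lintegral_abs_le {x : ℝ → ℝ} (hx : AEMeasurable x unitMeasure) :
    ENNReal.ofReal (φ 1) * ∫⁻ t, ENNReal.ofReal |x t| ∂unitMeasure ≤ lorentzNorm h.mono x := by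
  rw [← lintegral_distribution hx, ← lintegral_const_mul' _ _ ENNReal.ofReal_ne_top,
    lorentzNorm_eq h]
  refine lintegral_mono fun s => ?_
  rw [← ENNReal.ofReal_mul h.pos.le]
  refine ENNReal.ofReal_le_ofReal ?_
  have := h.mul_le (distribution_mem x s) (⟨zero_le_one, le_rfl⟩ : (1 : ℝ) ∈ Icc (0 : ℝ) 1)
  rw [mul_one] at this
  linarith [mul_comm (φ 1) (distribution x s)]

theorem integrable_of_lorentzNorm_lt_top {x : ℝ → ℝ} (hxm : AEMeasurable x unitMeasure)
    (hx : lorentzNorm h.mono x < ∞) : Integrable x unitMeasure := by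
  refine ⟨hxm.aestronglyMeasurable, ?_⟩
  rw [hasFiniteIntegral_iff_norm]
  by_contra htop
  have := (h.lintegral_abs_le hxm).trans_lt hx
  simp only [Real.norm_eq_abs, not_lt, top_le_iff] at htop
  rw [htop, ENNReal.mul_top (by simpa using h.pos)] at this
  exact this.false

/-- Uniformly bounded functions that are small in measure are small in the Lorentz norm. -/
theorem exists_lorentzNorm_le (M : ℝ) {ε : ℝ} (hε : 0 < ε) :
    ∃ η, 0 < η ∧ ∀ x : ℝ → ℝ, (∀ᵐ t ∂unitMeasure, |x t| ≤ M) → distribution x η ≤ η →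
      lorentzNorm h.mono x ≤ ENNReal.ofReal ε := by
  obtain ⟨δ, hδ, hδ1, hsm⟩ := h.exists_delta (ε := ε / (2 * (|M| + 1))) (by positivity)
  have hφ := h.pos
  refine ⟨min δ (ε / (2 * φ 1)), by positivity, fun x hxM hx => ?_⟩
  set η := min δ (ε / (2 * φ 1)) with hη
  have hη0 : 0 < η := by positivity
  rw [lorentzNorm_eq h]
  -- Levels up to `η` cost at most `φ 1 · η ≤ ε/2`. Levels between `η` and `|M| + 1` have
  -- distribution at most `δ` and cost at most `ε/2`. Above `|M| + 1` the distribution is zero.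
  have hbd : ∀ s ∈ Ioi (0 : ℝ), ENNReal.ofReal (φ (distribution x s)) ≤
      (Ioc 0 η).indicator (fun _ => ENNReal.ofReal (φ 1)) s
        + (Ioc 0 (|M| + 1)).indicator (fun _ => ENNReal.ofReal (ε / (2 * (|M| + 1)))) s := by
    intro s hs
    rcases le_or_gt s η with h1 | h1
    · rw [indicator_of_mem (show s ∈ Ioc 0 η from ⟨hs, h1⟩)]
      exact le_add_right (ENNReal.ofReal_le_ofReal (h.mono (distribution_mem _ _)
        ⟨zero_le_one, le_rfl⟩ (distribution_mem _ _).2))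
    · rcases le_or_gt s (|M| + 1) with h2 | h2
      · rw [indicator_of_mem (show s ∈ Ioc 0 (|M| + 1) from ⟨hs, h2⟩)]
        refine le_add_left (ENNReal.ofReal_le_ofReal (hsm _ (distribution_mem _ _).1 ?_).le)
        exact (distribution_antitone x h1.le).trans (hx.trans (min_le_left _ _))
      · have : distribution x s = 0 := by
          rw [distribution, measureReal_eq_zero_iff]
          refine measure_eq_zero_iff_ae_notMem.2 (hxM.mono fun t ht hs' => ?_)
          have := le_abs_self M
          simp only [mem_ofPred_eq] at hs'
          linarith
        simp [this, h.zero]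
  refine (setLIntegral_mono' measurableSet_Ioi hbd).trans ?_
  rw [lintegral_add_left (measurable_const.indicator measurableSet_Ioc),
    lintegral_indicator measurableSet_Ioc, lintegral_indicator measurableSet_Ioc,
    setLIntegral_const, setLIntegral_const]
  calc _ ≤ ENNReal.ofReal (φ 1) * volume (Ioc 0 η)
        + ENNReal.ofReal (ε / (2 * (|M| + 1))) * volume (Ioc 0 (|M| + 1)) := by
        gcongr <;> exact Measure.restrict_le_self
    _ = ENNReal.ofReal (φ 1 * η + ε / (2 * (|M| + 1)) * (|M| + 1)) := by
        rw [Real.volume_Ioc, Real.volume_Ioc, sub_zero, sub_zero, ← ENNReal.ofReal_mul h.pos.le,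
          ← ENNReal.ofReal_mul (by positivity), ← ENNReal.ofReal_add (by positivity)
          (by positivity)]
    _ ≤ _ := by
        refine ENNReal.ofReal_le_ofReal ?_
        have h1 : φ 1 * η ≤ φ 1 * (ε / (2 * φ 1)) := by gcongr; exact min_le_right _ _
        have h2 : φ 1 * (ε / (2 * φ 1)) = ε / 2 := by field_simp
        have h3 : ε / (2 * (|M| + 1)) * (|M| + 1) = ε / 2 := by field_simp
        linarith

theorem lorentzNorm_one : lorentzNorm h.mono (fun _ => 1) = ENNReal.ofReal (φ 1) := by
  have hd : ∀ s ∈ Ioi (0 : ℝ), ENNReal.ofReal (φ (distribution (fun _ => 1) s))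
      = (Iio 1).indicator (fun _ => ENNReal.ofReal (φ 1)) s := by
    intro s hs
    by_cases h1 : s < 1
    · simp [distribution, h1]
    · simp [distribution, h1, h.zero]
  rw [lorentzNorm_eq h, setLIntegral_congr_fun measurableSet_Ioi hd,
    lintegral_indicator measurableSet_Iio, setLIntegral_const,
    Measure.restrict_apply measurableSet_Iio, Iio_inter_Ioi]
  simp

end IsLorentzWeight

/-! ### Self-similarity of Lebesgue measure and dyadic tensor products. -/

theorem sum_fin_succ_fin_two {M : Type*} [AddCommMonoid M] {k : ℕ}
    (F : (Fin (k + 1) → Fin 2) → M) :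
    ∑ a, F a = (∑ b : Fin k → Fin 2, F (Fin.cons 0 b)) + ∑ b : Fin k → Fin 2, F (Fin.cons 1 b) := by
  rw [← (Fin.consEquiv fun _ => Fin 2).sum_comp, Fintype.sum_prod_type, Fin.sum_univ_two]
  rfl

theorem dyadicV_zero (a : Fin 0 → Fin 2) (f : ℝ → ℝ) : dyadicV ⟨0, a⟩ f = f := by
  simp [dyadicV]

theorem dyadicV_succ {k : ℕ} (a : Fin (k + 1) → Fin 2) (f : ℝ → ℝ) :
    dyadicV ⟨k + 1, a⟩ f = dyadicOp (a 0) (dyadicV ⟨k, Fin.tail a⟩ f) := by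
  simp only [dyadicV, List.ofFn_succ, List.foldr_cons]
  rfl

/-- The affine map of the unit interval onto the dyadic interval with binary address `a`. -/
def dyadicBranch : (k : ℕ) → (Fin k → Fin 2) → ℝ → ℝ
  | 0, _, t => t
  | k + 1, a, t => (dyadicBranch k (Fin.tail a) t + ((a 0 : ℕ) : ℝ)) / 2

theorem measurableEmbedding_add_div_two (c : ℝ) : MeasurableEmbedding fun t : ℝ => (t + c) / 2 :=
  (MeasurableEquiv.trans (MeasurableEquiv.addRight c)
    (Homeomorph.mulRight₀ (2⁻¹ : ℝ) (by norm_num)).toMeasurableEquiv).measurableEmbedding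

theorem measurableEmbedding_dyadicBranch (k : ℕ) (a : Fin k → Fin 2) :
    MeasurableEmbedding (dyadicBranch k a) := by
  induction k with
  | zero => exact MeasurableEmbedding.id
  | succ k ih => exact (measurableEmbedding_add_div_two _).comp (ih _)

theorem dyadicBranch_mem_Ioo (k : ℕ) (a : Fin k → Fin 2) {t : ℝ} (ht : t ∈ Ioo (0 : ℝ) 1) :
    dyadicBranch k a t ∈ Ioo (0 : ℝ) 1 := by
  induction k with
  | zero => exact ht
  | succ k ih =>
    obtain ⟨h0, h1⟩ := ih (Fin.tail a)
    have h2 : ((a 0 : ℕ) : ℝ) ≤ 1 := by exact_mod_cast Nat.lt_succ_iff.1 (a 0).2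
    have h3 : (0 : ℝ) ≤ ((a 0 : ℕ) : ℝ) := Nat.cast_nonneg _
    simp only [dyadicBranch]
    constructor <;> linarith

theorem unitMeasure_eq_half (S : Set ℝ) : unitMeasure S
    = 2⁻¹ * unitMeasure ((fun t : ℝ => (t + ((0 : Fin 2) : ℕ)) / 2) ⁻¹' S)
      + 2⁻¹ * unitMeasure ((fun t : ℝ => (t + ((1 : Fin 2) : ℕ)) / 2) ⁻¹' S) := by
  have hpre : ∀ (c : ℝ) (T : Set ℝ), 2⁻¹ * volume ((fun t : ℝ => (t + c) / 2) ⁻¹' T) = volume T := by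
    intro c T
    have : (fun t : ℝ => (t + c) / 2) ⁻¹' T = (fun t => t + c) ⁻¹' ((fun t => t * 2⁻¹) ⁻¹' T) := rfl
    rw [this, measure_preimage_add_right, Real.volume_preimage_mul_right (by norm_num)]
    rw [← mul_assoc, show (2⁻¹ : ℝ≥0∞) * ENNReal.ofReal |(2⁻¹ : ℝ)⁻¹| = 1 from ?_, one_mul]
    rw [inv_inv, abs_two, ENNReal.ofReal_ofNat, ENNReal.inv_mul_cancel] <;> norm_num
  have e0 : (fun t : ℝ => (t + ((0 : Fin 2) : ℕ)) / 2) ⁻¹' S ∩ Icc 0 1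
      = (fun t : ℝ => (t + (0 : ℝ)) / 2) ⁻¹' (S ∩ Icc 0 (1 / 2)) := by
    ext t
    simp only [mem_inter_iff, mem_preimage, mem_Icc, Fin.val_zero, Nat.cast_zero]
    refine and_congr_right fun _ => ?_
    constructor <;> rintro ⟨h1, h2⟩ <;> constructor <;> linarith
  have e1 : (fun t : ℝ => (t + ((1 : Fin 2) : ℕ)) / 2) ⁻¹' S ∩ Icc 0 1
      = (fun t : ℝ => (t + (1 : ℝ)) / 2) ⁻¹' (S ∩ Icc (1 / 2) 1) := by
    ext t
    simp only [mem_inter_iff, mem_preimage, mem_Icc, Fin.val_one, Nat.cast_one]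
    refine and_congr_right fun _ => ?_
    constructor <;> rintro ⟨h1, h2⟩ <;> constructor <;> linarith
  simp only [unitMeasure, Measure.restrict_apply' measurableSet_Icc]
  rw [e0, e1, hpre, hpre, ← measure_inter_add_sdiff (S ∩ Icc 0 1) (measurableSet_Iic (a := (1 / 2 : ℝ)))]
  congr 1
  · congr 1
    ext t
    simp only [mem_inter_iff, mem_Icc, mem_Iic]
    constructor
    · rintro ⟨⟨h1, h2, h3⟩, h4⟩; exact ⟨h1, h2, h4⟩
    · rintro ⟨h1, h2, h3⟩; exact ⟨⟨h1, h2, by linarith⟩, h3⟩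
  · rw [measure_congr ((ae_eq_refl S).inter Ioc_ae_eq_Icc.symm)]
    congr 1
    ext t
    simp only [Set.mem_sdiff, mem_inter_iff, mem_Icc, mem_Iic, mem_Ioc, not_le]
    constructor
    · rintro ⟨⟨h1, h2, h3⟩, h4⟩; exact ⟨h1, h4, h3⟩
    · rintro ⟨h1, h2, h3⟩; exact ⟨⟨h1, by linarith, h3⟩, h2⟩

/-- Lebesgue measure on `[0,1]` is the average of its images under the dyadic branches of a given
length. -/
theorem unitMeasure_eq_sum (k : ℕ) (S : Set ℝ) : unitMeasure S
    = (2 ^ k)⁻¹ * ∑ a : Fin k → Fin 2, unitMeasure (dyadicBranch k a ⁻¹' S) := by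
  induction k generalizing S with
  | zero =>
    simp [dyadicBranch, preimage]
  | succ k ih =>
    rw [unitMeasure_eq_half, ih (_ ⁻¹' S), ih (_ ⁻¹' S), sum_fin_succ_fin_two, pow_succ,
      ENNReal.mul_inv (by simp) (by simp), mul_add, mul_comm ((2 : ℝ≥0∞) ^ k)⁻¹ 2⁻¹, mul_assoc,
      mul_assoc]
    rfl

/-- Allows identities to be checked separately on each dyadic interval, in the coordinate that
rescales it to `[0,1]`. -/
theorem ae_unitMeasure_iff (k : ℕ) {p : ℝ → Prop} :
    (∀ᵐ t ∂unitMeasure, p t) ↔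
      ∀ a : Fin k → Fin 2, ∀ᵐ t ∂unitMeasure, p (dyadicBranch k a t) := by
  simp only [ae_iff]
  rw [unitMeasure_eq_sum k]
  simp only [mul_eq_zero, Finset.sum_eq_zero_iff, Finset.mem_univ, true_imp_iff]
  simp [preimage]

theorem ae_unitMeasure_mem_Ioo : ∀ᵐ t ∂unitMeasure, t ∈ Ioo (0 : ℝ) 1 := by
  rw [unitMeasure, ← restrict_Ioo_eq_restrict_Icc]
  exact ae_restrict_mem measurableSet_Ioo

theorem unitMeasure_eq_sum_map (k : ℕ) : unitMeasure
    = ((2 : ℝ≥0∞) ^ k)⁻¹ • ∑ a : Fin k → Fin 2, unitMeasure.map (dyadicBranch k a) := by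
  ext S hS
  rw [unitMeasure_eq_sum k]
  simp only [Measure.smul_apply, Measure.finsetSum_apply, smul_eq_mul,
    (measurableEmbedding_dyadicBranch k _).map_apply]

theorem lintegral_unitMeasure_eq_sum (k : ℕ) (G : ℝ → ℝ≥0∞) : ∫⁻ t, G t ∂unitMeasure
    = (2 ^ k)⁻¹ * ∑ a : Fin k → Fin 2, ∫⁻ t, G (dyadicBranch k a t) ∂unitMeasure := by
  conv_lhs => rw [unitMeasure_eq_sum_map k]
  rw [lintegral_smul_measure, lintegral_finsetSum_measure, smul_eq_mul]
  simp only [(measurableEmbedding_dyadicBranch k _).lintegral_map]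

theorem integrable_comp_dyadicBranch {k : ℕ} {G : ℝ → ℝ} (hG : Integrable G unitMeasure)
    (a : Fin k → Fin 2) : Integrable (fun t => G (dyadicBranch k a t)) unitMeasure := by
  refine (measurableEmbedding_dyadicBranch k a).integrable_map_iff.1 ?_
  rw [unitMeasure_eq_sum_map k, integrable_smul_measure (by simp) (by simp),
    integrable_finsetSum_measure] at hG
  exact hG a (Finset.mem_univ _)

theorem integral_unitMeasure_eq_sum (k : ℕ) {G : ℝ → ℝ} (hG : Integrable G unitMeasure) :
    ∫ t, G t ∂unitMeasure
    = (2 ^ k)⁻¹ * ∑ a : Fin k → Fin 2, ∫ t, G (dyadicBranch k a t) ∂unitMeasure := by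
  conv_lhs => rw [unitMeasure_eq_sum_map k]
  rw [integral_smul_measure, integral_finsetSum_measure]
  · simp only [(measurableEmbedding_dyadicBranch k _).integral_map, smul_eq_mul,
      ENNReal.toReal_inv, ENNReal.toReal_pow, ENNReal.toReal_ofNat]
  · intro a _
    exact (measurableEmbedding_dyadicBranch k a).integrable_map_iff.2
      (integrable_comp_dyadicBranch hG a)

theorem distribution_eq_sum (k : ℕ) (x : ℝ → ℝ) (s : ℝ) : distribution x s
    = (2 ^ k)⁻¹ * ∑ a : Fin k → Fin 2, distribution (fun t => x (dyadicBranch k a t)) s := by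
  unfold distribution
  simp only [measureReal_def]
  rw [unitMeasure_eq_sum k, ENNReal.toReal_mul, ENNReal.toReal_sum fun _ _ => measure_ne_top _ _,
    ENNReal.toReal_inv, ENNReal.toReal_pow, ENNReal.toReal_ofNat]
  rfl

theorem dyadicOp_branch (i j : Fin 2) (f : ℝ → ℝ) {t : ℝ} (ht : t ∈ Ioo (0 : ℝ) 1) :
    dyadicOp i f ((t + ((j : ℕ) : ℝ)) / 2) = if i = j then f t else 0 := by
  obtain ⟨h0, h1⟩ := ht
  fin_cases i <;> fin_cases j
  · simp only [dyadicOp]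
    rw [if_pos (by rfl), if_pos trivial, indicator_of_mem]
    · congr 1; simp; ring
    · simp; constructor <;> linarith
  · simp only [dyadicOp]
    rw [if_pos (by rfl), if_neg (by decide), indicator_of_notMem]
    simp; intro; linarith
  · simp only [dyadicOp]
    rw [if_neg (by decide), if_neg (by decide), indicator_of_notMem]
    simp; intro; linarith
  · simp only [dyadicOp]
    rw [if_neg (by decide), if_pos trivial, indicator_of_mem]
    · congr 1; simp; ring
    · simp; constructor <;> linarith

/-- Functions of one level live on different dyadic intervals. The restriction to interior points is
needed because neighbouring closed intervals share endpoints. -/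
theorem dyadicV_branch {k : ℕ} (b a : Fin k → Fin 2) (f : ℝ → ℝ) {t : ℝ}
    (ht : t ∈ Ioo (0 : ℝ) 1) :
    dyadicV ⟨k, b⟩ f (dyadicBranch k a t) = if b = a then f t else 0 := by
  induction k with
  | zero => rw [dyadicV_zero, if_pos (Subsingleton.elim _ _)]; rfl
  | succ k ih =>
    rw [dyadicV_succ, dyadicBranch, dyadicOp_branch _ _ _ (dyadicBranch_mem_Ioo k _ ht),
      ih (Fin.tail b) (Fin.tail a)]
    have hiff : b = a ↔ b 0 = a 0 ∧ Fin.tail b = Fin.tail a := by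
      constructor
      · rintro rfl; exact ⟨rfl, rfl⟩
      · rintro ⟨h1, h2⟩
        rw [← Fin.cons_self_tail b, ← Fin.cons_self_tail a, h1, h2]
    by_cases h1 : b 0 = a 0 <;> by_cases h2 : Fin.tail b = Fin.tail a <;> simp [hiff, h1, h2]

theorem measurable_dyadicOp (i : Fin 2) {f : ℝ → ℝ} (hf : Measurable f) :
    Measurable (dyadicOp i f) := by
  unfold dyadicOp
  split_ifs
  · exact (hf.comp (by fun_prop)).indicator measurableSet_Icc
  · exact (hf.comp (by fun_prop)).indicator measurableSet_Icc

theorem measurable_dyadicV {k : ℕ} (a : Fin k → Fin 2) {f : ℝ → ℝ} (hf : Measurable f) :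
    Measurable (dyadicV ⟨k, a⟩ f) := by
  induction k with
  | zero => rwa [dyadicV_zero]
  | succ k ih => rw [dyadicV_succ]; exact measurable_dyadicOp _ (ih _)

theorem aemeasurable_dyadicV {k : ℕ} (a : Fin k → Fin 2) {f : ℝ → ℝ}
    (hf : AEMeasurable f unitMeasure) : AEMeasurable (dyadicV ⟨k, a⟩ f) unitMeasure := by
  refine ⟨dyadicV ⟨k, a⟩ (hf.mk f), measurable_dyadicV a hf.measurable_mk, ?_⟩
  refine (ae_unitMeasure_iff k).2 fun b => ?_
  filter_upwards [hf.ae_eq_mk, ae_unitMeasure_mem_Ioo] with t h1 h2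
  rw [dyadicV_branch _ _ _ h2, dyadicV_branch _ _ _ h2, h1]

theorem dyadicOp_sum {ι : Type*} (S : Finset ι) (i : Fin 2) (g : ι → ℝ → ℝ) :
    dyadicOp i (fun t => ∑ b ∈ S, g b t) = fun t => ∑ b ∈ S, dyadicOp i (g b) t := by
  ext t
  unfold dyadicOp
  split_ifs
  · simp only [indicator]; split_ifs <;> simp
  · simp only [indicator]; split_ifs <;> simp

theorem dyadicV_sum {ι : Type*} (S : Finset ι) {k : ℕ} (a : Fin k → Fin 2) (g : ι → ℝ → ℝ) :
    dyadicV ⟨k, a⟩ (fun t => ∑ b ∈ S, g b t) = fun t => ∑ b ∈ S, dyadicV ⟨k, a⟩ (g b) t := by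
  induction k with
  | zero => simp only [dyadicV_zero]
  | succ k ih => simp only [dyadicV_succ, ih, dyadicOp_sum]

theorem dyadicV_append {k m : ℕ} (a : Fin k → Fin 2) (b : Fin m → Fin 2) (f : ℝ → ℝ) :
    dyadicV ⟨k + m, Fin.append a b⟩ f = dyadicV ⟨k, a⟩ (dyadicV ⟨m, b⟩ f) := by
  simp [dyadicV, List.ofFn_fin_append, List.foldr_append]

/-- The combination `∑_{|a| = k} ξ_a V^a f`, a tensor product of a dyadic step function with `f`. -/
def dyadicSum {k : ℕ} (ξ : (Fin k → Fin 2) → ℝ) (f : ℝ → ℝ) (t : ℝ) : ℝ :=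
  ∑ a, ξ a * dyadicV ⟨k, a⟩ f t

theorem dyadicSum_branch {k : ℕ} (ξ : (Fin k → Fin 2) → ℝ) (f : ℝ → ℝ) (a : Fin k → Fin 2) {t : ℝ}
    (ht : t ∈ Ioo (0 : ℝ) 1) : dyadicSum ξ f (dyadicBranch k a t) = ξ a * f t := by
  simp [dyadicSum, dyadicV_branch _ _ _ ht]

theorem aemeasurable_dyadicSum {k : ℕ} (ξ : (Fin k → Fin 2) → ℝ) {f : ℝ → ℝ}
    (hf : AEMeasurable f unitMeasure) : AEMeasurable (dyadicSum ξ f) unitMeasure :=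
  Finset.aemeasurable_fun_sum _ fun a _ => (aemeasurable_dyadicV a hf).const_mul (ξ a)

theorem distribution_congr {x y : ℝ → ℝ} (hxy : ∀ᵐ t ∂unitMeasure, x t = y t) (s : ℝ) :
    distribution x s = distribution y s := by
  unfold distribution
  simp only [measureReal_def]
  congr 1
  refine measure_congr (eventuallyEq_set.2 ?_)
  filter_upwards [hxy] with t ht
  simp only [ht]

/-- On the interval with address `a` the sum is a rescaled copy of `ξ a · f`, and all intervals of
the level have equal measure. -/
theorem distribution_dyadicSum {k : ℕ} (ξ : (Fin k → Fin 2) → ℝ) (f : ℝ → ℝ) (s : ℝ) :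
    distribution (dyadicSum ξ f) s
      = (2 ^ k)⁻¹ * ∑ a : Fin k → Fin 2, distribution (fun t => ξ a * f t) s := by
  rw [distribution_eq_sum k]
  congr 1
  refine Finset.sum_congr rfl fun a _ => distribution_congr ?_ s
  filter_upwards [ae_unitMeasure_mem_Ioo] with t ht
  exact dyadicSum_branch ξ f a ht

/-- The sum of the two dyadic copies of a function, i.e. composition with the doubling map. -/
def dyadicDouble (f : ℝ → ℝ) (t : ℝ) : ℝ := dyadicOp 0 f t + dyadicOp 1 f t

theorem dyadicDouble_iterate (m : ℕ) (f : ℝ → ℝ) :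
    dyadicDouble^[m] f = dyadicSum (fun _ : Fin m → Fin 2 => 1) f := by
  induction m with
  | zero => ext t; simp [dyadicSum, dyadicV_zero]
  | succ m ih =>
    rw [Function.iterate_succ', Function.comp_apply, ih]
    ext t
    unfold dyadicDouble dyadicSum
    simp only [one_mul, dyadicOp_sum, sum_fin_succ_fin_two, dyadicV_succ, Fin.cons_zero,
      Fin.tail_cons]

theorem dyadicDouble_iterate_branch (m : ℕ) (f : ℝ → ℝ) (a : Fin m → Fin 2) {t : ℝ}
    (ht : t ∈ Ioo (0 : ℝ) 1) : dyadicDouble^[m] f (dyadicBranch m a t) = f t := by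
  rw [dyadicDouble_iterate, dyadicSum_branch _ _ _ ht, one_mul]

theorem aemeasurable_dyadicDouble_iterate (m : ℕ) {f : ℝ → ℝ} (hf : AEMeasurable f unitMeasure) :
    AEMeasurable (dyadicDouble^[m] f) unitMeasure := by
  rw [dyadicDouble_iterate]; exact aemeasurable_dyadicSum _ hf

/-- Multiplying a step function of level `k` by `f` composed with the `(k+m)`-th iterate of doubling
stays within the system: the coefficients at level `k + m` depend only on the first `k` digits. -/
theorem dyadicSum_dyadicDouble_iterate {k : ℕ} (ξ : (Fin k → Fin 2) → ℝ) (m : ℕ) (f : ℝ → ℝ) :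
    dyadicSum ξ (dyadicDouble^[m] f)
      = dyadicSum (fun c : Fin (k + m) → Fin 2 => ξ fun i => c (Fin.castAdd m i)) f := by
  ext t
  rw [dyadicDouble_iterate]
  unfold dyadicSum
  simp only [one_mul, dyadicV_sum]
  rw [← (Fin.appendEquiv (α := Fin 2) k m).sum_comp, Fintype.sum_prod_type]
  refine Finset.sum_congr rfl fun a _ => ?_
  rw [Finset.mul_sum]
  refine Finset.sum_congr rfl fun b _ => ?_
  simp [Fin.appendEquiv, dyadicV_append]

/-! ### Dyadic neighbourhoods of the origin. -/

/-- A dyadic interval of length `2⁻ʲ` lies either inside or outside `[0, 2⁻ᵃ]` when `a ≤ j`. -/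
theorem dyadicBranch_lt_or_gt {j : ℕ} (b : Fin j → Fin 2) {a : ℕ} (haj : a ≤ j) :
    (∀ t ∈ Ioo (0 : ℝ) 1, dyadicBranch j b t < (1 / 2) ^ a) ∨
      ∀ t ∈ Ioo (0 : ℝ) 1, (1 / 2) ^ a < dyadicBranch j b t := by
  induction j generalizing a with
  | zero =>
    obtain rfl : a = 0 := by omega
    exact Or.inl fun t ht => by simpa [dyadicBranch] using ht.2
  | succ j ih =>
    rcases a with _ | a
    · exact Or.inl fun t ht => by simpa using (dyadicBranch_mem_Ioo _ b ht).2
    · have hpow : (1 / 2 : ℝ) ^ (a + 1) = (1 / 2) ^ a / 2 := by rw [pow_succ]; ring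
      have hle : (1 / 2 : ℝ) ^ a ≤ 1 := pow_le_one₀ (by norm_num) (by norm_num)
      rcases Fin.exists_fin_two.1 ⟨b 0, rfl⟩ with h0 | h0
      · rcases ih (Fin.tail b) (a := a) (by omega) with h | h
        · left; intro t ht
          have := h t ht
          simp only [dyadicBranch, h0, hpow, Fin.val_zero, Nat.cast_zero]; linarith
        · right; intro t ht
          have := h t ht
          simp only [dyadicBranch, h0, hpow, Fin.val_zero, Nat.cast_zero]; linarith
      · right; intro t ht
        have := (dyadicBranch_mem_Ioo _ (Fin.tail b) ht).1
        simp only [dyadicBranch, h0, hpow, Fin.val_one, Nat.cast_one]; linarith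

/-- A copy of `f` at level `j` begins at a multiple of `2⁻ʲ` and vanishes on the left half of its
interval, hence on `[0, 2^{-(j+1)})`. -/
theorem dyadicV_eq_zero_of_lt {f : ℝ → ℝ} (hf : ∀ t < 1 / 2, f t = 0) {j a : ℕ} (hja : j < a)
    (b : Fin j → Fin 2) {t : ℝ} (ht : t < (1 / 2) ^ a) : dyadicV ⟨j, b⟩ f t = 0 := by
  induction j generalizing a t with
  | zero =>
    rw [dyadicV_zero]
    refine hf t (ht.trans_le ?_)
    simpa using pow_le_pow_of_le_one (by norm_num : (0 : ℝ) ≤ 1 / 2) (by norm_num) hja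
  | succ j ih =>
    obtain ⟨a, rfl⟩ : ∃ a', a = a' + 1 := ⟨a - 1, by omega⟩
    have hpow : (1 / 2 : ℝ) ^ (a + 1) = (1 / 2) ^ a / 2 := by rw [pow_succ]; ring
    have hle : (1 / 2 : ℝ) ^ a ≤ 1 := pow_le_one₀ (by norm_num) (by norm_num)
    rw [dyadicV_succ]
    unfold dyadicOp
    split_ifs
    · simp only [indicator]
      split_ifs
      · exact ih (a := a) (by omega) _ (by linarith)
      · rfl
    · rw [indicator_of_notMem]
      simp only [mem_Icc, not_and_or, not_le]
      left; linarith

open Classical in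
/-- Addresses of the dyadic intervals of length `2⁻ʲ` contained in `[0, 2⁻ᵃ]`. -/
def leftAddresses (a j : ℕ) : Finset (Fin j → Fin 2) :=
  Finset.univ.filter fun b => ∀ t ∈ Ioo (0 : ℝ) 1, dyadicBranch j b t < (1 / 2) ^ a

/-- The indicator of `[0, 2⁻ᵃ)`. -/
def leftIndicator (a : ℕ) : ℝ → ℝ := (Iio ((1 / 2 : ℝ) ^ a)).indicator fun _ => 1

theorem measurable_leftIndicator (a : ℕ) : Measurable (leftIndicator a) :=
  measurable_const.indicator measurableSet_Iio

theorem leftIndicator_nonneg (a : ℕ) (t : ℝ) : 0 ≤ leftIndicator a t :=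
  indicator_nonneg (fun _ _ => zero_le_one) _

theorem leftIndicator_le_one (a : ℕ) (t : ℝ) : leftIndicator a t ≤ 1 :=
  indicator_le' (fun _ _ => le_rfl) (fun _ _ => zero_le_one) _

open Classical in
theorem leftIndicator_branch {a j : ℕ} (haj : a ≤ j) (b : Fin j → Fin 2) {t : ℝ}
    (ht : t ∈ Ioo (0 : ℝ) 1) :
    leftIndicator a (dyadicBranch j b t) = if b ∈ leftAddresses a j then 1 else 0 := by
  unfold leftIndicator leftAddresses
  simp only [Finset.mem_filter, Finset.mem_univ, true_and]
  split_ifs with hb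
  · exact indicator_of_mem (show _ ∈ Iio ((1 / 2 : ℝ) ^ a) from hb t ht) _
  · have := (dyadicBranch_lt_or_gt b haj).resolve_left hb t ht
    exact indicator_of_notMem (show _ ∉ Iio ((1 / 2 : ℝ) ^ a) from not_lt.2 this.le) _

theorem half_pow_mem (a : ℕ) : (1 / 2 : ℝ) ^ a ∈ Icc (0 : ℝ) 1 :=
  ⟨by positivity, pow_le_one₀ (by norm_num) (by norm_num)⟩

theorem unitMeasure_Iio {r : ℝ} (hr : r ∈ Icc (0 : ℝ) 1) :
    unitMeasure (Iio r) = ENNReal.ofReal r := by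
  rw [unitMeasure, Measure.restrict_apply measurableSet_Iio]
  have : Iio r ∩ Icc 0 1 = Ico 0 r := by
    ext t
    simp only [mem_inter_iff, mem_Iio, mem_Icc, mem_Ico]
    constructor
    · rintro ⟨h1, h2, _⟩; exact ⟨h2, h1⟩
    · rintro ⟨h1, h2⟩; exact ⟨h2, h1, h2.le.trans hr.2⟩
  rw [this, Real.volume_Ico, sub_zero]

theorem lintegral_leftIndicator (a : ℕ) :
    ∫⁻ t, ENNReal.ofReal (leftIndicator a t) ∂unitMeasure = ENNReal.ofReal ((1 / 2) ^ a) := by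
  rw [← unitMeasure_Iio (half_pow_mem a), ← lintegral_indicator_one measurableSet_Iio]
  refine lintegral_congr fun t => ?_
  unfold leftIndicator
  by_cases ht : t ∈ Iio ((1 / 2 : ℝ) ^ a) <;> simp only [indicator_of_mem, ht,
    indicator_of_notMem, not_false_eq_true, ENNReal.ofReal_one, ENNReal.ofReal_zero, Pi.one_apply]

theorem lintegral_leftIndicator_mul_dyadicSum {a j : ℕ} (haj : a ≤ j) (ξ : (Fin j → Fin 2) → ℝ)
    (f : ℝ → ℝ) :
    ∫⁻ t, ENNReal.ofReal (leftIndicator a t * |dyadicSum ξ f t|) ∂unitMeasure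
      = (2 ^ j)⁻¹ * ∑ b ∈ leftAddresses a j,
        ENNReal.ofReal |ξ b| * ∫⁻ t, ENNReal.ofReal |f t| ∂unitMeasure := by
  classical
  rw [lintegral_unitMeasure_eq_sum j, ← Finset.sum_filter_add_sum_filter_not Finset.univ
    (fun b => b ∈ leftAddresses a j)]
  congr 1
  have h2 : ∀ b ∈ Finset.univ.filter (fun b => b ∉ leftAddresses a j),
      ∫⁻ t, ENNReal.ofReal (leftIndicator a (dyadicBranch j b t)
        * |dyadicSum ξ f (dyadicBranch j b t)|) ∂unitMeasure = 0 := by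
    intro b hb
    rw [lintegral_congr_ae (g := fun _ => 0), lintegral_zero]
    filter_upwards [ae_unitMeasure_mem_Ioo] with t ht
    rw [leftIndicator_branch haj b ht, if_neg (Finset.mem_filter.1 hb).2]
    simp
  rw [Finset.sum_eq_zero h2, add_zero, Finset.filter_univ_mem]
  refine Finset.sum_congr rfl fun b hb => ?_
  rw [← lintegral_const_mul' _ _ ENNReal.ofReal_ne_top]
  refine lintegral_congr_ae ?_
  filter_upwards [ae_unitMeasure_mem_Ioo] with t ht
  rw [leftIndicator_branch haj b ht, if_pos hb, dyadicSum_branch _ _ _ ht, one_mul, abs_mul,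
    ENNReal.ofReal_mul (abs_nonneg _)]

/-- No counting is involved: integrating the constant function `1` over `[0, 2⁻ᵃ)` branch by branch
gives the number of addresses. -/
theorem card_leftAddresses {a j : ℕ} (haj : a ≤ j) :
    ((2 : ℝ) ^ j)⁻¹ * (leftAddresses a j).card = (1 / 2) ^ a := by
  have h1 := lintegral_leftIndicator_mul_dyadicSum haj (fun _ => 1) (fun _ => 1)
  have h2 : ∫⁻ t, ENNReal.ofReal (leftIndicator a t
      * |dyadicSum (fun _ : Fin j → Fin 2 => 1) (fun _ => 1) t|) ∂unitMeasure
      = ∫⁻ t, ENNReal.ofReal (leftIndicator a t) ∂unitMeasure := by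
    refine lintegral_congr_ae ((ae_unitMeasure_iff j).2 fun b => ?_)
    filter_upwards [ae_unitMeasure_mem_Ioo] with t ht
    rw [dyadicSum_branch _ _ _ ht]
    simp
  rw [h2, lintegral_leftIndicator] at h1
  have h3 := congrArg ENNReal.toReal h1
  rw [ENNReal.toReal_ofReal (by positivity)] at h3
  rw [h3]
  simp

/-! ### Necessity: tensor products with indicators of `[0, 2⁻ᵃ)`. -/

namespace IsLorentzWeight

variable {φ : ℝ → ℝ} (h : IsLorentzWeight φ)
include h

theorem lorentzNorm_leftIndicator (a : ℕ) :
    lorentzNorm h.mono (leftIndicator a) = ENNReal.ofReal (φ ((1 / 2) ^ a)) := by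
  have hd : ∀ s ∈ Ioi (0 : ℝ), ENNReal.ofReal (φ (distribution (leftIndicator a) s))
      = (Iio 1).indicator (fun _ => ENNReal.ofReal (φ ((1 / 2) ^ a))) s := by
    intro s hs
    have hs0 : 0 < s := hs
    by_cases h1 : s < 1
    · rw [indicator_of_mem (by exact h1)]
      congr 2
      have : {u | s < |leftIndicator a u|} = Iio ((1 / 2 : ℝ) ^ a) := by
        ext u
        by_cases hu : u < (1 / 2 : ℝ) ^ a
        · have : leftIndicator a u = 1 := indicator_of_mem (by exact hu) _
          simp only [mem_ofPred_eq, this, abs_one, h1, mem_Iio, hu]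
        · have : leftIndicator a u = 0 := indicator_of_notMem (by exact hu) _
          simp only [mem_ofPred_eq, this, abs_zero, mem_Iio, hu, not_lt.2 hs0.le]
      rw [distribution, this, measureReal_def, unitMeasure_Iio (half_pow_mem a),
        ENNReal.toReal_ofReal (half_pow_mem a).1]
    · rw [indicator_of_notMem (by exact h1)]
      have : {u | s < |leftIndicator a u|} = ∅ := by
        ext u
        simp only [mem_ofPred_eq, mem_empty_iff_false, iff_false, not_lt]
        rw [abs_of_nonneg (leftIndicator_nonneg a u)]
        exact (leftIndicator_le_one a u).trans (not_lt.1 h1)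
      simp [distribution, this, h.zero]
  rw [lorentzNorm_eq h, setLIntegral_congr_fun measurableSet_Ioi hd,
    lintegral_indicator measurableSet_Iio, setLIntegral_const,
    Measure.restrict_apply measurableSet_Iio, Iio_inter_Ioi]
  simp

/-- Averaging over a dyadic interval does not increase the norm of a tensor product. -/
theorem sum_leftAddresses_mul_le {a j : ℕ} (haj : a ≤ j) (ξ : (Fin j → Fin 2) → ℝ) (f : ℝ → ℝ) :
    (∑ b ∈ leftAddresses a j, ENNReal.ofReal |ξ b|)
        * ∫⁻ s in Ioi (0 : ℝ), ENNReal.ofReal (φ ((1 / 2) ^ a * distribution f s))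
      ≤ (leftAddresses a j).card * lorentzNorm h.mono (dyadicSum ξ f) := by
  set B := leftAddresses a j
  have hcard := card_leftAddresses haj
  have hB : (0 : ℝ) < B.card := by
    by_contra hcon
    have : (0 : ℝ) < (1 / 2) ^ a := by positivity
    rw [← hcard] at this
    exact hcon (pos_of_mul_pos_right this (by positivity))
  have hmem : ∀ (g : ℝ → ℝ) (s : ℝ), (1 / 2 : ℝ) ^ a * distribution g s ∈ Icc (0 : ℝ) 1 := by
    intro g s
    have h1 := half_pow_mem a
    have h2 := distribution_mem g s
    exact ⟨mul_nonneg h1.1 h2.1, mul_le_one₀ h1.2 h2.1 h2.2⟩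
  have hterm : ∀ b, ∫⁻ s in Ioi (0 : ℝ),
      ENNReal.ofReal (φ ((1 / 2) ^ a * distribution (fun t => ξ b * f t) s))
      = ENNReal.ofReal |ξ b|
        * ∫⁻ s in Ioi (0 : ℝ), ENNReal.ofReal (φ ((1 / 2) ^ a * distribution f s)) := by
    intro b
    rcases eq_or_ne (ξ b) 0 with h0 | h0
    · rw [h0, abs_zero, ENNReal.ofReal_zero, zero_mul,
        setLIntegral_congr_fun measurableSet_Ioi (g := fun _ => 0), lintegral_zero]
      intro s hs
      simp [distribution, not_lt.2 (le_of_lt (mem_Ioi.1 hs)), h.zero]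
    · simp only [distribution_const_mul f h0]
      exact lintegral_Ioi_comp_div
        (fun s => ENNReal.ofReal (φ ((1 / 2) ^ a * distribution f s))) (abs_pos.2 h0)
  rw [Finset.sum_mul, lorentzNorm_eq h]
  simp only [← hterm]
  rw [← lintegral_const_mul' _ _ (by simp)]
  have hmeas : ∀ g : ℝ → ℝ, Measurable fun s =>
      ENNReal.ofReal (φ ((1 / 2) ^ a * distribution g s)) := by
    intro g
    refine ENNReal.measurable_ofReal.comp (Antitone.measurable fun s t hst => ?_)
    exact h.mono (hmem _ _) (hmem _ _)
      (mul_le_mul_of_nonneg_left (distribution_antitone g hst) (by positivity))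
  rw [← lintegral_finsetSum _ fun b _ => hmeas _]
  refine lintegral_mono fun s => ?_
  simp only
  rw [← ENNReal.ofReal_sum_of_nonneg fun b _ => h.nonneg (hmem _ _), ← ENNReal.ofReal_natCast,
    ← ENNReal.ofReal_mul (Nat.cast_nonneg _)]
  refine ENNReal.ofReal_le_ofReal ?_
  -- Jensen's inequality at a fixed level `s`, with equal weights on the left addresses. Since `2⁻ᵃ
  -- / card = 2⁻ʲ`, the averaged argument is the part of the distribution of the whole sum that
  -- comes from these addresses.
  have hJ := h.conc.le_map_sum (t := B) (w := fun _ => (B.card : ℝ)⁻¹)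
    (p := fun b => (1 / 2) ^ a * distribution (fun t => ξ b * f t) s)
    (fun _ _ => by positivity) (by simp [hB.ne']) (fun _ _ => hmem _ _)
  simp only [smul_eq_mul, ← Finset.mul_sum] at hJ
  have he : (B.card : ℝ)⁻¹ * ((1 / 2) ^ a * ∑ b ∈ B, distribution (fun t => ξ b * f t) s)
      = ((2 : ℝ) ^ j)⁻¹ * ∑ b ∈ B, distribution (fun t => ξ b * f t) s := by
    rw [← hcard]; field_simp; rfl
  rw [he] at hJ
  have hle : ((2 : ℝ) ^ j)⁻¹ * ∑ b ∈ B, distribution (fun t => ξ b * f t) s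
      ≤ distribution (dyadicSum ξ f) s := by
    rw [distribution_dyadicSum]
    refine mul_le_mul_of_nonneg_left ?_ (by positivity)
    exact Finset.sum_le_univ_sum_of_nonneg fun b => (distribution_mem _ _).1
  have hmono := h.mono ⟨mul_nonneg (by positivity) (Finset.sum_nonneg fun b _ =>
    (distribution_mem _ _).1), hle.trans (distribution_mem _ _).2⟩ (distribution_mem _ _) hle
  have := hJ.trans hmono
  rwa [inv_mul_le_iff₀ hB] at this

/-- For `j < a` the left side is zero by the support of `f`. For `j ≥ a` the integral is a multiple
of `∑ |ξ b|` over the left addresses, which `sum_leftAddresses_mul_le` bounds. -/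
theorem lintegral_leftIndicator_mul_le {f : ℝ → ℝ} (hf : ∀ t < 1 / 2, f t = 0) (a : ℕ) {j : ℕ}
    (ξ : (Fin j → Fin 2) → ℝ) :
    (∫⁻ t, ENNReal.ofReal (leftIndicator a t * |dyadicSum ξ f t|) ∂unitMeasure)
        * ∫⁻ s in Ioi (0 : ℝ), ENNReal.ofReal (φ ((1 / 2) ^ a * distribution f s))
      ≤ ENNReal.ofReal ((1 / 2) ^ a) * (∫⁻ t, ENNReal.ofReal |f t| ∂unitMeasure)
        * lorentzNorm h.mono (dyadicSum ξ f) := by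
  rcases lt_or_ge j a with hja | haj
  · have : ∀ t, leftIndicator a t * |dyadicSum ξ f t| = 0 := by
      intro t
      by_cases ht : t < (1 / 2) ^ a
      · simp [dyadicSum, dyadicV_eq_zero_of_lt hf hja _ ht]
      · rw [leftIndicator, indicator_of_notMem (show t ∉ Iio ((1 / 2 : ℝ) ^ a) from ht), zero_mul]
    simp [this]
  · rw [lintegral_leftIndicator_mul_dyadicSum haj, ← Finset.sum_mul]
    have hc : ENNReal.ofReal ((1 / 2) ^ a) = (2 ^ j)⁻¹ * ((leftAddresses a j).card : ℝ≥0∞) := by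
      rw [← card_leftAddresses haj, ENNReal.ofReal_mul (by positivity), ENNReal.ofReal_natCast,
        ENNReal.ofReal_inv_of_pos (by positivity), ENNReal.ofReal_pow (by norm_num),
        ENNReal.ofReal_ofNat]
    rw [hc]
    calc _ = (2 ^ j)⁻¹ * (∫⁻ t, ENNReal.ofReal |f t| ∂unitMeasure)
          * ((∑ b ∈ leftAddresses a j, ENNReal.ofReal |ξ b|)
            * ∫⁻ s in Ioi (0 : ℝ), ENNReal.ofReal (φ ((1 / 2) ^ a * distribution f s))) := by ring
      _ ≤ (2 ^ j)⁻¹ * (∫⁻ t, ENNReal.ofReal |f t| ∂unitMeasure)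
          * ((leftAddresses a j).card * lorentzNorm h.mono (dyadicSum ξ f)) := by
          exact mul_le_mul_right (h.sum_leftAddresses_mul_le haj ξ f) _
      _ = _ := by ring

omit h in
/-- The multi-indices of length less than `n`. -/
def _root_.shortIndices (n : ℕ) : Finset DyadicIndex :=
  (Finset.range n).sigma fun _ => Finset.univ

omit h in
theorem _root_.mem_shortIndices {n : ℕ} {α : DyadicIndex} : α ∈ shortIndices n ↔ α.1 < n := by
  simp [shortIndices]

omit h in
theorem _root_.sum_shortIndices (ξ : DyadicIndex → ℝ) (f : ℝ → ℝ) (n : ℕ) (t : ℝ) :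
    ∑ α ∈ shortIndices n, ξ α * dyadicV α f t
      = ∑ j ∈ Finset.range n, dyadicSum (fun b : Fin j → Fin 2 => ξ ⟨j, b⟩) f t := by
  rw [shortIndices, Finset.sum_sigma]
  rfl

omit h in
theorem _root_.tendsto_shortIndices : Tendsto shortIndices atTop atTop := by
  refine tendsto_atTop_finset_of_monotone (fun m n hmn α hα => ?_) fun α => ⟨α.1 + 1, ?_⟩
  · exact mem_shortIndices.2 ((mem_shortIndices.1 hα).trans_le hmn)
  · exact mem_shortIndices.2 (Nat.lt_succ_self _)

/-- If a nonnegative function supported in `[1/2,1]` generates an absolutely representing system,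
its tensor products with the indicators of `[0,2⁻ᵃ]` are controlled. -/
theorem exists_lintegral_le_of_representing {f : ℝ → ℝ} (hfm : Measurable f)
    (hf : ∀ t < 1 / 2, f t = 0) (hfin : lorentzNorm h.mono f < ∞)
    (hrep : IsAbsolutelyRepresentingSystem h.mono f) :
    ∃ C : ℝ, ∀ a : ℕ, ∫⁻ s in Ioi (0 : ℝ), ENNReal.ofReal (φ ((1 / 2) ^ a * distribution f s))
      ≤ ENNReal.ofReal (C * φ ((1 / 2) ^ a)) := by
  obtain ⟨C, hC, hrep⟩ := hrep
  set I := ∫⁻ t, ENNReal.ofReal |f t| ∂unitMeasure with hI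
  have hφ : ENNReal.ofReal (φ 1) ≠ 0 := by simpa using h.pos
  have hIfin : I ≠ ∞ := by
    intro htop
    have := (h.lintegral_abs_le hfm.aemeasurable).trans_lt hfin
    rw [← hI, htop, ENNReal.mul_top hφ] at this
    exact this.false
  refine ⟨I.toReal * C, fun a => ?_⟩
  set Q := ∫⁻ s in Ioi (0 : ℝ), ENNReal.ofReal (φ ((1 / 2) ^ a * distribution f s)) with hQ
  have ha := half_pow_mem a
  -- Finiteness of `Q` is used in the limit: the residual is multiplied by `Q` and must still tend
  -- to `0`.
  have hQfin : Q ≠ ∞ := by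
    refine (lt_of_le_of_lt ?_ hfin).ne
    rw [lorentzNorm_eq h, hQ]
    refine lintegral_mono fun s => ENNReal.ofReal_le_ofReal ?_
    have hd := distribution_mem f s
    exact h.mono ⟨mul_nonneg ha.1 hd.1, mul_le_one₀ ha.2 hd.1 hd.2⟩ hd
      (mul_le_of_le_one_left hd.1 ha.2)
  set x := leftIndicator a with hx
  have hxm : MemLorentz h.mono x := ⟨(measurable_leftIndicator a).aemeasurable, by
    rw [h.lorentzNorm_leftIndicator]; exact ENNReal.ofReal_lt_top⟩
  obtain ⟨ξ, hlim, hsum⟩ := hrep x hxm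
  let r : ℕ → ℝ → ℝ := fun n t => x t - ∑ α ∈ shortIndices n, ξ α * dyadicV α f t
  let y : (j : ℕ) → ℝ → ℝ := fun j => dyadicSum (fun b : Fin j → Fin 2 => ξ ⟨j, b⟩) f
  have hym : ∀ j, Measurable (y j) := fun j =>
    Finset.measurable_fun_sum _ fun b _ => (measurable_dyadicV b hfm).const_mul _
  have hrm : ∀ n, Measurable (r n) := by
    intro n
    refine (measurable_leftIndicator a).sub (Finset.measurable_fun_sum _ fun α _ => ?_)
    exact (measurable_dyadicV α.2 hfm).const_mul _
  have hr0 : Tendsto (fun n => lorentzNorm h.mono (r n)) atTop (𝓝 0) :=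
    hlim.comp tendsto_shortIndices
  -- On `[0, 2⁻ᵃ)` one has `1 ≤ |r n| + ∑ |y j|`. Integrate, multiply by `Q` and estimate each level
  -- separately; the bound on the sum of level norms then makes the right side uniform in `n` apart
  -- from the residual.
  have hbound : ∀ n, ENNReal.ofReal ((1 / 2) ^ a) * Q ≤
      ((ENNReal.ofReal (φ 1))⁻¹ * lorentzNorm h.mono (r n)) * Q
        + ENNReal.ofReal ((1 / 2) ^ a) * I * (ENNReal.ofReal C * lorentzNorm h.mono x) := by
    intro n
    have h1 : ENNReal.ofReal ((1 / 2) ^ a) ≤ ∫⁻ t, (ENNReal.ofReal |r n t|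
        + ∑ j ∈ Finset.range n, ENNReal.ofReal (x t * |y j t|)) ∂unitMeasure := by
      rw [← lintegral_leftIndicator]
      refine lintegral_mono fun t => ?_
      rw [← ENNReal.ofReal_sum_of_nonneg fun j _ =>
        mul_nonneg (leftIndicator_nonneg a t) (abs_nonneg _),
        ← ENNReal.ofReal_add (abs_nonneg _) (Finset.sum_nonneg fun j _ =>
        mul_nonneg (leftIndicator_nonneg a t) (abs_nonneg _))]
      refine ENNReal.ofReal_le_ofReal ?_
      by_cases ht : t < (1 / 2 : ℝ) ^ a
      · have hx1 : x t = 1 := indicator_of_mem (show t ∈ Iio ((1 / 2 : ℝ) ^ a) from ht) _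
        have hr : r n t = 1 - ∑ j ∈ Finset.range n, y j t := by
          simp only [r, hx1, sum_shortIndices, y]
        have h2 := Finset.abs_sum_le_sum_abs (fun j => y j t) (Finset.range n)
        have h3 : (1 : ℝ) ≤ |r n t| + |∑ j ∈ Finset.range n, y j t| := by
          rw [hr]
          have := abs_add_le (1 - ∑ j ∈ Finset.range n, y j t) (∑ j ∈ Finset.range n, y j t)
          rwa [sub_add_cancel, abs_one] at this
        rw [← hx, hx1]
        simp only [one_mul]
        linarith
      · have hx1 : x t = 0 := indicator_of_notMem (show t ∉ Iio ((1 / 2 : ℝ) ^ a) from ht) _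
        rw [← hx, hx1]
        simp
    rw [lintegral_add_left (by fun_prop), lintegral_finsetSum _ fun j _ => by
      have := hym j
      have := measurable_leftIndicator a
      fun_prop] at h1
    have h2 : ∫⁻ t, ENNReal.ofReal |r n t| ∂unitMeasure
        ≤ (ENNReal.ofReal (φ 1))⁻¹ * lorentzNorm h.mono (r n) := by
      rw [mul_comm, ← div_eq_mul_inv, ENNReal.le_div_iff_mul_le (Or.inl hφ)
        (Or.inl ENNReal.ofReal_ne_top), mul_comm]
      exact h.lintegral_abs_le (hrm n).aemeasurable
    calc ENNReal.ofReal ((1 / 2) ^ a) * Q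
        ≤ ((ENNReal.ofReal (φ 1))⁻¹ * lorentzNorm h.mono (r n)
          + ∑ j ∈ Finset.range n, ∫⁻ t, ENNReal.ofReal (x t * |y j t|) ∂unitMeasure) * Q := by
          gcongr
          exact h1.trans (add_le_add_left h2 _)
      _ = ((ENNReal.ofReal (φ 1))⁻¹ * lorentzNorm h.mono (r n)) * Q
          + ∑ j ∈ Finset.range n,
            (∫⁻ t, ENNReal.ofReal (x t * |y j t|) ∂unitMeasure) * Q := by
          rw [add_mul, Finset.sum_mul]
      _ ≤ ((ENNReal.ofReal (φ 1))⁻¹ * lorentzNorm h.mono (r n)) * Q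
          + ∑ j ∈ Finset.range n,
            ENNReal.ofReal ((1 / 2) ^ a) * I * lorentzNorm h.mono (y j) := by
          refine add_le_add_right (Finset.sum_le_sum fun j _ => ?_) _
          exact h.lintegral_leftIndicator_mul_le hf a _
      _ ≤ _ := by
          rw [← Finset.mul_sum]
          gcongr
          exact (ENNReal.sum_le_tsum _).trans hsum
  have hlimit : Tendsto (fun n => ((ENNReal.ofReal (φ 1))⁻¹ * lorentzNorm h.mono (r n)) * Q
        + ENNReal.ofReal ((1 / 2) ^ a) * I * (ENNReal.ofReal C * lorentzNorm h.mono x)) atTop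
      (𝓝 (((ENNReal.ofReal (φ 1))⁻¹ * 0) * Q
        + ENNReal.ofReal ((1 / 2) ^ a) * I * (ENNReal.ofReal C * lorentzNorm h.mono x))) :=
    (ENNReal.Tendsto.mul_const (ENNReal.Tendsto.const_mul hr0
      (Or.inr (ENNReal.inv_ne_top.2 hφ))) (Or.inr hQfin)).add tendsto_const_nhds
  have hfinal := ge_of_tendsto' hlimit hbound
  rw [mul_zero, zero_mul, zero_add, h.lorentzNorm_leftIndicator, mul_assoc,
    ENNReal.mul_le_mul_iff_right (by simp) ENNReal.ofReal_ne_top] at hfinal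
  rw [mul_assoc, ENNReal.ofReal_mul ENNReal.toReal_nonneg, ENNReal.ofReal_toReal hIfin,
    ENNReal.ofReal_mul hC.le]
  exact hfinal

end IsLorentzWeight

/-! ### Necessity: a function that detects the failure of submultiplicativity. -/

namespace IsLorentzWeight

variable {φ : ℝ → ℝ} (h : IsLorentzWeight φ)
include h

theorem exists_dyadic_of_not_submultiplicative (hns : ¬ IsSubmultiplicative φ) {K : ℝ}
    (hK : 0 < K) : ∃ (a : ℕ) (t : ℝ), 0 < t ∧ t ≤ 1 / 2 ∧
      K * φ ((1 / 2) ^ a) * φ t < φ ((1 / 2) ^ a * t) := by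
  -- Of the factor `4`, one `2` pays for replacing `s` by the dyadic `r` with `r/2 < s ≤ r`, where
  -- `φ r ≤ 2 φ s`, and the other for replacing `t` by `t/2`.
  have hns' : ∃ s ∈ Icc (0 : ℝ) 1, ∃ t ∈ Icc (0 : ℝ) 1, 4 * K * φ s * φ t < φ (s * t) := by
    by_contra! hcon
    exact hns ⟨4 * K, by positivity, hcon⟩
  obtain ⟨s, hs, t, ht, hst⟩ := hns'
  have hs0 : 0 < s := by
    rcases hs.1.eq_or_lt with rfl | h0
    · simp [h.zero] at hst
    · exact h0
  have ht0 : 0 < t := by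
    rcases ht.1.eq_or_lt with rfl | h0
    · simp [h.zero] at hst
    · exact h0
  obtain ⟨a, ha1, ha2⟩ := exists_nat_pow_near_of_lt_one hs0 hs.2
    (by norm_num : (0 : ℝ) < 1 / 2) (by norm_num)
  rw [pow_succ] at ha1
  have ha := half_pow_mem a
  set r := (1 / 2 : ℝ) ^ a with hr
  have hr0 : 0 < r := by positivity
  refine ⟨a, t / 2, by linarith, by linarith [ht.2], ?_⟩
  have hc : s / r ∈ Icc (0 : ℝ) 1 := ⟨by positivity, (div_le_one hr0).2 ha2⟩
  have h1 := h.mul_le hc ha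
  rw [div_mul_cancel₀ _ hr0.ne'] at h1
  have h1' : φ r ≤ 2 * φ s := by
    have : (1 / 2 : ℝ) ≤ s / r := by rw [le_div_iff₀ hr0]; linarith
    nlinarith [h.nonneg ha]
  have hstm : s * t ∈ Icc (0 : ℝ) 1 := ⟨by positivity, mul_le_one₀ hs.2 ht.1 ht.2⟩
  have h2 := h.mul_le (c := 1 / 2) ⟨by norm_num, by norm_num⟩ hstm
  have hrt : r * (t / 2) ≤ 1 := mul_le_one₀ ha.2 (by positivity) (by linarith [ht.2])
  have hle : 1 / 2 * (s * t) ≤ r * (t / 2) := by nlinarith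
  have h3 := h.mono (⟨by positivity, hle.trans hrt⟩ : 1 / 2 * (s * t) ∈ Icc (0 : ℝ) 1)
    ⟨by positivity, hrt⟩ hle
  have h4 := h.mono (⟨by positivity, by linarith [ht.2]⟩ : t / 2 ∈ Icc (0 : ℝ) 1) ht (by linarith)
  have h5 := h.nonneg hs
  have h6 := h.nonneg ht
  have h7 := h.nonneg (⟨by positivity, by linarith [ht.2]⟩ : t / 2 ∈ Icc (0 : ℝ) 1)
  calc K * φ r * φ (t / 2) ≤ K * (2 * φ s) * φ t := by gcongr
    _ = 1 / 2 * (4 * K * φ s * φ t) := by ring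
    _ < 1 / 2 * φ (s * t) := by linarith
    _ ≤ _ := h2.trans h3

omit h in
theorem _root_.unitMeasure_Ico_one {t : ℝ} (ht1 : t ≤ 1) :
    unitMeasure (Ico (1 - t) 1) = ENNReal.ofReal t := by
  rw [unitMeasure, Measure.restrict_apply measurableSet_Ico, inter_eq_left.2, Real.volume_Ico,
    sub_sub_cancel]
  exact fun u hu => ⟨by linarith [hu.1], hu.2.le⟩

omit h in
/-- The supremum of the multiples `c i` of the indicators of `[1 - t i, 1)`. -/
def _root_.supIndicator (c t : ℕ → ℝ) (u : ℝ) : ℝ :=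
  ⨆ i, (Ico (1 - t i) 1).indicator (fun _ => c i) u

omit h in
-- Since `t i → 0`, a point `u < 1` lies in only finitely many of the intervals; excluding `1` from
-- them avoids the one point common to all.
theorem _root_.bddAbove_supIndicator {c t : ℕ → ℝ} (ht : Tendsto t atTop (𝓝 0)) (u : ℝ) :
    BddAbove (range fun i => (Ico (1 - t i) 1).indicator (fun _ => c i) u) := by
  rcases lt_or_ge u 1 with hu | hu
  · obtain ⟨N, hN⟩ := eventually_atTop.1 (ht.eventually (gt_mem_nhds (sub_pos.2 hu)))
    refine ((finite_singleton (0 : ℝ)).union ((finite_Iio N).image c)).bddAbove.mono ?_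
    rintro _ ⟨i, rfl⟩
    by_cases hi : u ∈ Ico (1 - t i) 1
    · right
      refine ⟨i, ?_, (indicator_of_mem hi fun _ => c i).symm⟩
      by_contra hcon
      have := hN i (not_lt.1 hcon)
      linarith [hi.1]
    · left
      exact indicator_of_notMem hi _
  · refine (finite_singleton (0 : ℝ)).bddAbove.mono ?_
    rintro _ ⟨i, rfl⟩
    exact indicator_of_notMem (fun hi => (hi.2.trans_le hu).false) _

omit h in
theorem _root_.supIndicator_nonneg {c t : ℕ → ℝ} (hc : ∀ i, 0 ≤ c i) (u : ℝ) :
    0 ≤ supIndicator c t u :=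
  Real.iSup_nonneg fun i => indicator_nonneg (fun _ _ => hc i) _

omit h in
theorem _root_.le_supIndicator {c t : ℕ → ℝ} (ht : Tendsto t atTop (𝓝 0)) {i : ℕ} {u : ℝ}
    (hu : u ∈ Ico (1 - t i) 1) : c i ≤ supIndicator c t u := by
  have := le_ciSup (bddAbove_supIndicator (c := c) ht u) i
  simp only [indicator_of_mem hu] at this
  exact this

omit h in
theorem _root_.exists_of_lt_supIndicator {c t : ℕ → ℝ} {s u : ℝ} (hs : 0 ≤ s)
    (hu : s < supIndicator c t u) : ∃ i, s < c i ∧ u ∈ Ico (1 - t i) 1 := by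
  obtain ⟨i, hi⟩ := exists_lt_of_lt_ciSup hu
  refine ⟨i, ?_⟩
  by_cases hui : u ∈ Ico (1 - t i) 1
  · rw [indicator_of_mem hui] at hi
    exact ⟨hi, hui⟩
  · rw [indicator_of_notMem hui] at hi
    exact absurd hi (not_lt.2 hs)

omit h in
theorem _root_.measurable_supIndicator (c t : ℕ → ℝ) : Measurable (supIndicator c t) :=
  Measurable.iSup fun _ => measurable_const.indicator measurableSet_Ico

omit h in
theorem _root_.le_distribution_supIndicator {c t : ℕ → ℝ} (ht : Tendsto t atTop (𝓝 0))
    (ht0 : ∀ i, 0 ≤ t i) (ht1 : ∀ i, t i ≤ 1) {i : ℕ} {s : ℝ} (hs : s < c i) :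
    t i ≤ distribution (supIndicator c t) s := by
  have h1 : unitMeasure.real (Ico (1 - t i) 1) = t i := by
    rw [measureReal_def, unitMeasure_Ico_one (ht1 i), ENNReal.toReal_ofReal (ht0 i)]
  rw [← h1]
  refine measureReal_mono fun u hu => ?_
  exact hs.trans_le ((le_supIndicator ht hu).trans (le_abs_self _))

/-- The intervals are nested, so the set above level `s` is one of them, and its `φ`-value is a
single term of the layer-cake sum. Taking a supremum instead of a sum avoids an infinite triangle
inequality. -/
theorem lorentzNorm_supIndicator_le {c t : ℕ → ℝ} (ht : Tendsto t atTop (𝓝 0))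
    (hc : ∀ i, 0 ≤ c i) (ht0 : ∀ i, 0 < t i) (ht1 : ∀ i, t i ≤ 1) :
    lorentzNorm h.mono (supIndicator c t) ≤ ∑' i, ENNReal.ofReal (c i * φ (t i)) := by
  have hpt : ∀ s ∈ Ioi (0 : ℝ), ENNReal.ofReal (φ (distribution (supIndicator c t) s))
      ≤ ∑' i, (Iio (c i)).indicator (fun _ => ENNReal.ofReal (φ (t i))) s := by
    intro s hs
    rcases (distribution_mem (supIndicator c t) s).1.eq_or_lt with h0 | h0
    · simp [← h0, h.zero]
    have hsub : {u | s < |supIndicator c t u|} ⊆ {u | ∃ i, s < c i ∧ u ∈ Ico (1 - t i) 1} := by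
      intro u hu
      simp only [mem_ofPred_eq, abs_of_nonneg (supIndicator_nonneg hc u)] at hu
      exact exists_of_lt_supIndicator (le_of_lt hs) hu
    have hex : ∃ i, s < c i := by
      by_contra! hcon
      have : {u | s < |supIndicator c t u|} = ∅ := by
        refine subset_empty_iff.1 (hsub.trans ?_)
        rintro u ⟨i, hi, _⟩
        exact absurd hi (not_lt.2 (hcon i))
      simp [distribution, this] at h0
    obtain ⟨i, hi⟩ := hex
    obtain ⟨N, hN⟩ := eventually_atTop.1 (ht.eventually (gt_mem_nhds (ht0 i)))
    classical
    -- The largest `t j` among the active indices exists: beyond `N` all `t j` are smaller than `t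
    -- i`.
    obtain ⟨m, hm, hmax⟩ := ((Finset.range (max N (i + 1))).filter fun j => s < c j).exists_max_image
      t ⟨i, Finset.mem_filter.2 ⟨Finset.mem_range.2 (by omega), hi⟩⟩
    have hmc := (Finset.mem_filter.1 hm).2
    have him := hmax i (Finset.mem_filter.2 ⟨Finset.mem_range.2 (by omega), hi⟩)
    have hmax' : ∀ j, s < c j → t j ≤ t m := by
      intro j hj
      by_cases hjN : j < max N (i + 1)
      · exact hmax j (Finset.mem_filter.2 ⟨Finset.mem_range.2 hjN, hj⟩)
      · exact (hN j (by omega)).le.trans him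
    have hd : distribution (supIndicator c t) s ≤ t m := by
      have h1 : unitMeasure.real (Ico (1 - t m) 1) = t m := by
        rw [measureReal_def, unitMeasure_Ico_one (ht1 m),
          ENNReal.toReal_ofReal (ht0 m).le]
      rw [← h1]
      refine measureReal_mono fun u hu => ?_
      obtain ⟨j, hj, hju⟩ := hsub hu
      exact ⟨by linarith [hju.1, hmax' j hj], hju.2⟩
    calc _ ≤ ENNReal.ofReal (φ (t m)) := ENNReal.ofReal_le_ofReal
          (h.mono (distribution_mem _ _) ⟨(ht0 m).le, ht1 m⟩ hd)
      _ = (Iio (c m)).indicator (fun _ => ENNReal.ofReal (φ (t m))) s :=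
          (indicator_of_mem (show s ∈ Iio (c m) from hmc)
            fun _ => ENNReal.ofReal (φ (t m))).symm
      _ ≤ _ := ENNReal.le_tsum m
  rw [lorentzNorm_eq h]
  refine (setLIntegral_mono' measurableSet_Ioi hpt).trans (le_of_eq ?_)
  rw [lintegral_tsum fun i => (measurable_const.indicator measurableSet_Iio).aemeasurable]
  refine tsum_congr fun i => ?_
  rw [lintegral_indicator measurableSet_Iio, setLIntegral_const,
    Measure.restrict_apply measurableSet_Iio, Iio_inter_Ioi, Real.volume_Ioo, sub_zero, mul_comm,
    ENNReal.ofReal_mul (hc i)]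

/-- Failures of submultiplicativity with constants `4ⁱ` are combined into one function. Its norm is
finite because the `i`-th piece has norm `2⁻ⁱ`, while the `i`-th failure forces the constant of
`exists_lintegral_le_of_representing` above `2ⁱ`. -/
theorem isSubmultiplicative_of_representing
    (hrep : ∀ f : ℝ → ℝ, MemLorentz h.mono f → (∫ t in (0 : ℝ)..1, f t) ≠ 0 →
      IsAbsolutelyRepresentingSystem h.mono f) : IsSubmultiplicative φ := by
  by_contra hns
  choose a t ht0 ht2 hat using fun i : ℕ =>
    h.exists_dyadic_of_not_submultiplicative hns (K := 4 ^ i) (by positivity)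
  have ht1 : ∀ i, t i ≤ 1 := fun i => (ht2 i).trans (by norm_num)
  have hφt : ∀ i, 0 < φ (t i) := fun i => h.pos_of_pos (ht0 i) (ht1 i)
  have hφa : ∀ i, 0 < φ ((1 / 2) ^ a i) := fun i =>
    h.pos_of_pos (by positivity) (half_pow_mem _).2
  have hmem : ∀ i, (1 / 2) ^ a i * t i ∈ Icc (0 : ℝ) 1 := fun i =>
    ⟨mul_nonneg (half_pow_mem _).1 (ht0 i).le, mul_le_one₀ (half_pow_mem _).2 (ht0 i).le (ht1 i)⟩
  -- `4ⁱ φ(r) φ(t) < φ(rt) ≤ φ(r)` gives `φ(t) < 4⁻ⁱ`, and `t φ(1) ≤ φ(t)` by concavity.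
  have htbd : ∀ i, t i ≤ (1 / 4) ^ i * (φ 1)⁻¹ := by
    intro i
    have h1 := h.mono (hmem i) (half_pow_mem (a i))
      (mul_le_of_le_one_right (half_pow_mem _).1 (ht1 i))
    have h2 := h.mul_le (⟨(ht0 i).le, ht1 i⟩ : t i ∈ Icc (0 : ℝ) 1)
      (⟨zero_le_one, le_rfl⟩ : (1 : ℝ) ∈ Icc (0 : ℝ) 1)
    rw [mul_one] at h2
    have h3 : 4 ^ i * φ (t i) < 1 := by
      have := (hat i).trans_le h1
      have h4 : φ ((1 / 2) ^ a i) * (4 ^ i * φ (t i)) < φ ((1 / 2) ^ a i) * 1 := by linarith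
      exact lt_of_mul_lt_mul_left h4 (hφa i).le
    have h5 : (1 / 4 : ℝ) ^ i = (4 ^ i)⁻¹ := by rw [one_div, inv_pow]
    rw [h5, ← mul_inv, ← one_div, le_div_iff₀ (mul_pos (by positivity) h.pos)]
    have : (4 : ℝ) ^ i * (t i * φ 1) ≤ 4 ^ i * φ (t i) := by gcongr
    linarith
  have ht : Tendsto t atTop (𝓝 0) := by
    refine squeeze_zero (fun i => (ht0 i).le) htbd ?_
    simpa using (tendsto_pow_atTop_nhds_zero_of_lt_one (by norm_num : (0 : ℝ) ≤ 1 / 4)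
      (by norm_num)).mul_const (φ 1)⁻¹
  set c : ℕ → ℝ := fun i => (1 / 2) ^ i / φ (t i) with hcdef
  have hc : ∀ i, 0 < c i := fun i => div_pos (by positivity) (hφt i)
  have hcφ : ∀ i, c i * φ (t i) = (1 / 2) ^ i := fun i => div_mul_cancel₀ _ (hφt i).ne'
  set f := supIndicator c t with hf
  have hfm : Measurable f := measurable_supIndicator c t
  have hf0 : ∀ u, 0 ≤ f u := supIndicator_nonneg fun i => (hc i).le
  have hfin : lorentzNorm h.mono f < ∞ := by
    refine (h.lorentzNorm_supIndicator_le ht (fun i => (hc i).le) ht0 ht1).trans_lt ?_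
    simp only [hcφ]
    rw [← ENNReal.ofReal_tsum_of_nonneg (fun i => by positivity) summable_geometric_two]
    exact ENNReal.ofReal_lt_top
  have hfsupp : ∀ u < 1 / 2, f u = 0 := by
    intro u hu
    have : ∀ i, (Ico (1 - t i) 1).indicator (fun _ => c i) u = 0 := fun i =>
      indicator_of_notMem (fun hi => by linarith [hi.1, ht2 i]) _
    simp [f, supIndicator, this]
  have hfint := h.integrable_of_lorentzNorm_lt_top hfm.aemeasurable hfin
  have hne : (∫ u in (0 : ℝ)..1, f u) ≠ 0 := by
    rw [intervalIntegral.integral_of_le zero_le_one, ← integral_Icc_eq_integral_Ioc]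
    refine ((integral_pos_iff_support_of_nonneg hf0 hfint).2 ?_).ne'
    refine lt_of_lt_of_le ?_ (measure_mono (s := Ico (1 - t 0) 1) fun u hu =>
      ((hc 0).trans_le (le_supIndicator ht hu)).ne')
    rw [unitMeasure_Ico_one (ht1 0)]
    exact ENNReal.ofReal_pos.2 (ht0 0)
  obtain ⟨C, hC⟩ := h.exists_lintegral_le_of_representing hfm hfsupp hfin
    (hrep f ⟨hfm.aemeasurable, hfin⟩ hne)
  -- Below level `c i` the distribution of `f` is at least `t i`, so the integral in `hC` is at
  -- least `c i · φ(r t i) > c i · 4ⁱ φ(r) φ(t i) = 2ⁱ φ(r)`.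
  have hlow : ∀ i, (2 : ℝ) ^ i ≤ C := by
    intro i
    have h1 : ENNReal.ofReal (c i * φ ((1 / 2) ^ a i * t i))
        ≤ ENNReal.ofReal (C * φ ((1 / 2) ^ a i)) := by
      refine le_trans ?_ (hC (a i))
      calc ENNReal.ofReal (c i * φ ((1 / 2) ^ a i * t i))
          = ∫⁻ _ in Ioo 0 (c i), ENNReal.ofReal (φ ((1 / 2) ^ a i * t i)) := by
            rw [setLIntegral_const, Real.volume_Ioo, sub_zero, mul_comm,
              ENNReal.ofReal_mul (h.nonneg (hmem i))]
        _ ≤ ∫⁻ s in Ioo 0 (c i), ENNReal.ofReal (φ ((1 / 2) ^ a i * distribution f s)) := by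
            refine setLIntegral_mono' measurableSet_Ioo fun s hs => ENNReal.ofReal_le_ofReal ?_
            have hd := distribution_mem f s
            refine h.mono (hmem i) ⟨mul_nonneg (half_pow_mem _).1 hd.1,
              mul_le_one₀ (half_pow_mem _).2 hd.1 hd.2⟩ ?_
            exact mul_le_mul_of_nonneg_left (le_distribution_supIndicator ht
              (fun i => (ht0 i).le) ht1 hs.2) (half_pow_mem _).1
        _ ≤ _ := lintegral_mono_set Ioo_subset_Ioi_self
    have hpos : 0 < c i * φ ((1 / 2) ^ a i * t i) := mul_pos (hc i)
      (h.pos_of_pos (mul_pos (by positivity) (ht0 i)) (hmem i).2)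
    have h2 : c i * φ ((1 / 2) ^ a i * t i) ≤ C * φ ((1 / 2) ^ a i) := by
      by_contra hcon
      refine absurd h1 (not_le.2 ((ENNReal.ofReal_lt_ofReal_iff hpos).2 (not_le.1 hcon)))
    have h3 := mul_lt_mul_of_pos_left (hat i) (hc i)
    have h4 : c i * (4 ^ i * φ ((1 / 2) ^ a i) * φ (t i)) = 2 ^ i * φ ((1 / 2) ^ a i) := by
      have h5 : (1 / 2 : ℝ) ^ i * 4 ^ i = 2 ^ i := by rw [← mul_pow]; norm_num
      linear_combination (4 ^ i * φ ((1 / 2) ^ a i)) * hcφ i + φ ((1 / 2) ^ a i) * h5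
    rw [h4] at h3
    exact le_of_mul_le_mul_right (h3.le.trans h2) (hφa i)
  obtain ⟨i, hi⟩ := pow_unbounded_of_one_lt C (by norm_num : (1 : ℝ) < 2)
  exact absurd hi (not_lt.2 (hlow i))

end IsLorentzWeight

/-! ### Sufficiency: boundedness of dyadic tensor products. -/

theorem dyadicBranch_eq_add (k : ℕ) (a : Fin k → Fin 2) (t : ℝ) :
    dyadicBranch k a t = dyadicBranch k a 0 + t / 2 ^ k := by
  induction k with
  | zero => simp [dyadicBranch]
  | succ k ih => simp only [dyadicBranch]; rw [ih (Fin.tail a), pow_succ]; field_simp; ring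

theorem distribution_dyadicDouble_iterate (m : ℕ) (f : ℝ → ℝ) (s : ℝ) :
    distribution (dyadicDouble^[m] f) s = distribution f s := by
  rw [dyadicDouble_iterate, distribution_dyadicSum]
  simp

theorem ofReal_half_mul_two (r : ℝ) : ENNReal.ofReal (r / 2) + ENNReal.ofReal (r / 2)
    = ENNReal.ofReal r := by
  rcases le_total 0 r with hr | hr
  · rw [← ENNReal.ofReal_add (by positivity) (by positivity), add_halves]
  · rw [ENNReal.ofReal_of_nonpos hr, ENNReal.ofReal_of_nonpos (by linarith), add_zero]

namespace IsLorentzWeight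

variable {φ : ℝ → ℝ} (h : IsLorentzWeight φ)
include h

theorem lorentzNorm_dyadicDouble_iterate (m : ℕ) (f : ℝ → ℝ) :
    lorentzNorm h.mono (dyadicDouble^[m] f) = lorentzNorm h.mono f := by
  simp only [lorentzNorm_eq h, distribution_dyadicDouble_iterate]

theorem lorentzNorm_dyadicSum_mono {k : ℕ} {ξ ζ : (Fin k → Fin 2) → ℝ} (hle : ∀ a, |ξ a| ≤ |ζ a|)
    (f : ℝ → ℝ) : lorentzNorm h.mono (dyadicSum ξ f) ≤ lorentzNorm h.mono (dyadicSum ζ f) := by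
  refine h.lorentzNorm_mono ((ae_unitMeasure_iff k).2 fun a => ?_)
  filter_upwards [ae_unitMeasure_mem_Ioo] with t ht
  rw [dyadicSum_branch _ _ _ ht, dyadicSum_branch _ _ _ ht, abs_mul, abs_mul]
  exact mul_le_mul_of_nonneg_right (hle a) (abs_nonneg _)

omit h in
theorem card_div_mem {k : ℕ} (S : Finset (Fin k → Fin 2)) :
    ((2 : ℝ) ^ k)⁻¹ * S.card ∈ Icc (0 : ℝ) 1 := by
  refine ⟨by positivity, ?_⟩
  have h1 : (S.card : ℝ) ≤ 2 ^ k := by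
    have := S.card_le_univ
    simp only [Fintype.card_pi, Fintype.card_fin, Finset.prod_const, Finset.card_univ] at this
    exact_mod_cast this
  rw [inv_mul_le_iff₀ (by positivity), mul_one]
  exact h1

open Classical in
/-- Layer-cake formula for the norm of a nonnegative dyadic step function. -/
theorem lorentzNorm_dyadicSum_one {k : ℕ} {ξ : (Fin k → Fin 2) → ℝ} (hξ : ∀ a, 0 ≤ ξ a) :
    lorentzNorm h.mono (dyadicSum ξ fun _ => 1) = ∫⁻ s in Ioi (0 : ℝ),
      ENNReal.ofReal (φ ((2 ^ k)⁻¹ * (Finset.univ.filter fun a => s < ξ a).card)) := by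
  rw [lorentzNorm_eq h]
  refine lintegral_congr fun s => ?_
  rw [distribution_dyadicSum]
  congr 3
  rw [Finset.card_filter, Nat.cast_sum]
  refine Finset.sum_congr rfl fun a _ => ?_
  by_cases hs : s < ξ a <;> simp [distribution, abs_of_nonneg (hξ a), hs]

open Classical in
-- The distribution of this tensor product is the measure of the union of the intervals in `S` times
-- that of `f`, so submultiplicativity applies at every level `s`.
theorem lorentzNorm_dyadicSum_indicator_le {C : ℝ} (hC : 0 < C)
    (hsub : ∀ s ∈ Icc (0 : ℝ) 1, ∀ t ∈ Icc (0 : ℝ) 1, φ (s * t) ≤ C * φ s * φ t)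
    {k : ℕ} (S : Finset (Fin k → Fin 2)) (f : ℝ → ℝ) :
    lorentzNorm h.mono (dyadicSum (fun a => if a ∈ S then 1 else 0) f)
      ≤ ENNReal.ofReal (C * φ ((2 ^ k)⁻¹ * S.card)) * lorentzNorm h.mono f := by
  rw [lorentzNorm_eq h, lorentzNorm_eq h, ← lintegral_const_mul' _ _ ENNReal.ofReal_ne_top]
  refine setLIntegral_mono' measurableSet_Ioi fun s hs => ?_
  have hS := card_div_mem S
  rw [← ENNReal.ofReal_mul (mul_nonneg hC.le (h.nonneg hS))]
  refine ENNReal.ofReal_le_ofReal (le_trans (le_of_eq ?_) (hsub _ hS _ (distribution_mem f s)))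
  rw [distribution_dyadicSum, mul_assoc]
  congr 2
  have hterm : ∀ a, distribution (fun t => (if a ∈ S then 1 else 0) * f t) s
      = if a ∈ S then distribution f s else 0 := by
    intro a
    split_ifs
    · simp
    · simp [distribution, not_lt.2 (le_of_lt (mem_Ioi.1 hs))]
  rw [Finset.sum_congr rfl fun a _ => hterm a]
  simp

/-- For a submultiplicative weight the tensor product of a dyadic step function with a function is
bounded in the Lorentz norm. -/
theorem lorentzNorm_dyadicSum_le {C : ℝ} (hC : 0 < C)
    (hsub : ∀ s ∈ Icc (0 : ℝ) 1, ∀ t ∈ Icc (0 : ℝ) 1, φ (s * t) ≤ C * φ s * φ t)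
    {k : ℕ} (ξ : (Fin k → Fin 2) → ℝ) {f : ℝ → ℝ} (hf : AEMeasurable f unitMeasure) :
    lorentzNorm h.mono (dyadicSum ξ f) ≤ ENNReal.ofReal C
      * lorentzNorm h.mono (dyadicSum ξ fun _ => 1) * lorentzNorm h.mono f := by
  classical
  -- Induction on the number of positive coefficients: subtracting the smallest positive value `m`
  -- on the support `S` removes at least one of them.
  have key : ∀ (n : ℕ) (ζ : (Fin k → Fin 2) → ℝ), (∀ a, 0 ≤ ζ a) →
      (Finset.univ.filter fun a => 0 < ζ a).card ≤ n →
      lorentzNorm h.mono (dyadicSum ζ f) ≤ ENNReal.ofReal C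
        * lorentzNorm h.mono (dyadicSum ζ fun _ => 1) * lorentzNorm h.mono f := by
    intro n
    induction n with
    | zero =>
      intro ζ hζ hcard
      have hz : ∀ a, ζ a = 0 := by
        intro a
        by_contra hne
        have : a ∈ Finset.univ.filter fun a => 0 < ζ a := by
          simpa using lt_of_le_of_ne (hζ a) (Ne.symm hne)
        have := Finset.card_pos.2 ⟨a, this⟩
        omega
      have : dyadicSum ζ f = fun _ => 0 := by ext t; simp [dyadicSum, hz]
      rw [this, h.lorentzNorm_zero]
      exact zero_le
    | succ n ih =>
      intro ζ hζ hcard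
      set S := Finset.univ.filter fun a => 0 < ζ a with hS
      rcases S.eq_empty_or_nonempty with hemp | hne
      · exact ih ζ hζ (by rw [← hS, hemp]; simp)
      obtain ⟨a₀, ha₀, hmin⟩ := S.exists_min_image ζ hne
      set m := ζ a₀ with hm
      have hm0 : 0 < m := (Finset.mem_filter.1 ha₀).2
      set ζ' : (Fin k → Fin 2) → ℝ := fun a => ζ a - m * (if a ∈ S then 1 else 0) with hζ'
      have hoff : ∀ a, a ∉ S → ζ a = 0 := by
        intro a ha
        refine le_antisymm (not_lt.1 fun hp => ha ?_) (hζ a)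
        exact Finset.mem_filter.2 ⟨Finset.mem_univ _, hp⟩
      have hζ'0 : ∀ a, 0 ≤ ζ' a := by
        intro a
        by_cases ha : a ∈ S
        · simpa [hζ', ha] using hmin a ha
        · simp [hζ', ha, hoff a ha]
      have hsubS : (Finset.univ.filter fun a => 0 < ζ' a) ⊆ S.erase a₀ := by
        intro a ha
        have ha' := (Finset.mem_filter.1 ha).2
        refine Finset.mem_erase.2 ⟨?_, ?_⟩
        · rintro rfl
          simp [hζ', ha₀, hm] at ha'
        · by_contra haS
          simp [hζ', haS, hoff a haS] at ha'
      have hcard' : (Finset.univ.filter fun a => 0 < ζ' a).card ≤ n := by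
        refine (Finset.card_le_card hsubS).trans ?_
        rw [Finset.card_erase_of_mem ha₀]
        omega
      have hdec : dyadicSum ζ f = fun t =>
          m * dyadicSum (fun a => if a ∈ S then 1 else 0) f t + dyadicSum ζ' f t := by
        ext t
        simp only [dyadicSum, Finset.mul_sum, ← Finset.sum_add_distrib]
        refine Finset.sum_congr rfl fun a _ => ?_
        simp only [hζ']
        ring
      -- The layer `m · 1_S` and the remainder split the layer-cake integral at `m`, so their norms
      -- add up without loss and the constant `C` survives the induction.
      have hlayer : ENNReal.ofReal (m * φ ((2 ^ k)⁻¹ * S.card))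
          + lorentzNorm h.mono (dyadicSum ζ' fun _ => 1)
          ≤ lorentzNorm h.mono (dyadicSum ζ fun _ => 1) := by
        have hsplit : ∀ G : ℝ → ℝ≥0∞, ∫⁻ s in Ioi (0 : ℝ), G s
            = (∫⁻ s in Ioc 0 m, G s) + ∫⁻ s in Ioi m, G s := by
          intro G
          rw [← Ioc_union_Ioi_eq_Ioi hm0.le, lintegral_union measurableSet_Ioi
            (Set.disjoint_left.2 fun s hs hs' => not_lt.2 hs.2 hs')]
        rw [h.lorentzNorm_dyadicSum_one hζ, hsplit, h.lorentzNorm_dyadicSum_one hζ'0]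
        refine add_le_add ?_ ?_
        · rw [setLIntegral_congr Ioo_ae_eq_Ioc.symm, setLIntegral_congr_fun measurableSet_Ioo
            (g := fun _ => ENNReal.ofReal (φ ((2 ^ k)⁻¹ * S.card)))]
          · rw [setLIntegral_const, Real.volume_Ioo, sub_zero, mul_comm,
              ENNReal.ofReal_mul' hm0.le]
          · intro s hs
            have : (Finset.univ.filter fun a => s < ζ a) = S := by
              ext a
              simp only [Finset.mem_filter, Finset.mem_univ, true_and, hS]
              constructor
              · exact fun hp => hs.1.trans hp
              · intro hp
                exact hs.2.trans_le (hmin a (Finset.mem_filter.2 ⟨Finset.mem_univ _, hp⟩))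
            simp only [this]
        · rw [← lintegral_Ioi_comp_add _ m]
          refine le_of_eq (setLIntegral_congr_fun measurableSet_Ioi fun s hs => ?_)
          have hs0 : 0 < s := hs
          have : (Finset.univ.filter fun a => s < ζ' a)
              = Finset.univ.filter fun a => s + m < ζ a := by
            ext a
            simp only [Finset.mem_filter, Finset.mem_univ, true_and]
            by_cases ha : a ∈ S
            · simp only [hζ', ha, if_true]
              constructor <;> intro _ <;> linarith
            · simp only [hζ', ha, if_false, hoff a ha]
              constructor <;> intro _ <;> linarith
          simp only [this]
      rw [hdec]
      calc _ ≤ ENNReal.ofReal |m|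
              * lorentzNorm h.mono (dyadicSum (fun a => if a ∈ S then 1 else 0) f)
            + lorentzNorm h.mono (dyadicSum ζ' f) := by
            rw [← h.lorentzNorm_const_mul]
            exact h.lorentzNorm_add_le ((aemeasurable_dyadicSum _ hf).const_mul m)
              (aemeasurable_dyadicSum _ hf)
        _ ≤ ENNReal.ofReal |m| * (ENNReal.ofReal (C * φ ((2 ^ k)⁻¹ * S.card))
              * lorentzNorm h.mono f)
            + ENNReal.ofReal C * lorentzNorm h.mono (dyadicSum ζ' fun _ => 1)
              * lorentzNorm h.mono f :=
            add_le_add (mul_le_mul_right (h.lorentzNorm_dyadicSum_indicator_le hC hsub S f) _)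
              (ih ζ' hζ'0 hcard')
        _ = ENNReal.ofReal C * (ENNReal.ofReal (m * φ ((2 ^ k)⁻¹ * S.card))
            + lorentzNorm h.mono (dyadicSum ζ' fun _ => 1)) * lorentzNorm h.mono f := by
            rw [abs_of_pos hm0, ENNReal.ofReal_mul hC.le, ENNReal.ofReal_mul hm0.le]
            ring
        _ ≤ _ := by gcongr
  have habs : ∀ g : ℝ → ℝ, lorentzNorm h.mono (dyadicSum ξ g)
      = lorentzNorm h.mono (dyadicSum (fun a => |ξ a|) g) := fun g =>
    le_antisymm (h.lorentzNorm_dyadicSum_mono (fun a => (abs_abs _).ge) g)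
      (h.lorentzNorm_dyadicSum_mono (fun a => (abs_abs _).le) g)
  rw [habs, habs]
  exact key _ _ (fun a => abs_nonneg _) le_rfl

/-! ### Density of dyadic step functions. -/

/-- Truncations approximate an element of the Lorentz space. -/
theorem exists_truncation {x : ℝ → ℝ} (hx : lorentzNorm h.mono x < ∞) {ε : ℝ} (hε : 0 < ε) :
    ∃ M : ℝ, 0 < M ∧
      lorentzNorm h.mono (fun t => x t - max (-M) (min M (x t))) ≤ ENNReal.ofReal ε := by
  set G : ℝ → ℝ≥0∞ := fun s => ENNReal.ofReal (φ (distribution x s)) with hG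
  -- The norm of `x` is the total mass of this measure. Truncation at `M` shifts levels by `M`, so
  -- the error is at most the mass of `(M, ∞)`, a tail of a finite measure.
  set μ := (volume.restrict (Ioi (0 : ℝ))).withDensity G with hμ
  have hfin : IsFiniteMeasure μ :=
    isFiniteMeasure_withDensity (by rw [hG, ← lorentzNorm_eq h]; exact hx.ne)
  have hlim : Tendsto (fun n : ℕ => μ (Ioi (n : ℝ))) atTop (𝓝 0) := by
    have := tendsto_measure_iInter_atTop (μ := μ) (s := fun n : ℕ => Ioi (n : ℝ))
      (fun n => measurableSet_Ioi.nullMeasurableSet)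
      (fun m n hmn => Ioi_subset_Ioi (Nat.cast_le.2 hmn)) ⟨0, measure_ne_top _ _⟩
    rwa [show (⋂ n : ℕ, Ioi (n : ℝ)) = ∅ from ?_, measure_empty] at this
    refine eq_empty_of_forall_notMem fun s hs => ?_
    obtain ⟨n, hn⟩ := exists_nat_gt s
    exact absurd (mem_iInter.1 hs n) (not_lt.2 hn.le)
  obtain ⟨N, hN⟩ := eventually_atTop.1
    (ENNReal.tendsto_nhds_zero.1 hlim (ENNReal.ofReal ε) (ENNReal.ofReal_pos.2 hε))
  refine ⟨N + 1, by positivity, ?_⟩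
  set M : ℝ := N + 1 with hM
  have hM0 : 0 < M := by positivity
  have hval : μ (Ioi M) = ∫⁻ s in Ioi M, G s := by
    rw [hμ, withDensity_apply _ measurableSet_Ioi, Measure.restrict_restrict measurableSet_Ioi,
      inter_eq_left.2 (Ioi_subset_Ioi hM0.le)]
  have hle := hN (N + 1) (by omega)
  push_cast at hle
  rw [hval, ← lintegral_Ioi_comp_add] at hle
  refine le_trans ?_ hle
  rw [lorentzNorm_eq h]
  refine setLIntegral_mono' measurableSet_Ioi fun s hs => ENNReal.ofReal_le_ofReal ?_
  refine h.mono (distribution_mem _ _) (distribution_mem _ _) (measureReal_mono fun t ht => ?_)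
  simp only [mem_ofPred_eq] at ht ⊢
  have hs0 : 0 < s := hs
  rcases le_total M (x t) with h1 | h1
  · rw [min_eq_left h1, max_eq_right (by linarith), abs_of_nonneg (by linarith)] at ht
    linarith [le_abs_self (x t)]
  · rw [min_eq_right h1] at ht
    rcases le_total (-M) (x t) with h2 | h2
    · rw [max_eq_right h2, sub_self, abs_zero] at ht
      linarith
    · rw [max_eq_left h2, abs_of_nonpos (by linarith)] at ht
      linarith [neg_abs_le (x t)]

omit h in
theorem distribution_le_of_lintegral_le {x : ℝ → ℝ} (hx : AEMeasurable x unitMeasure) {η δ : ℝ}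
    (hη : 0 < η) (hδ : 0 ≤ δ) (hle : ∫⁻ t, ENNReal.ofReal |x t| ∂unitMeasure ≤ ENNReal.ofReal δ) :
    distribution x η ≤ δ / η := by
  have h1 := mul_meas_ge_le_lintegral₀ (μ := unitMeasure) (f := fun t => ENNReal.ofReal |x t|)
    (by fun_prop) (ENNReal.ofReal η)
  have h2 : unitMeasure {u | η < |x u|}
      ≤ unitMeasure {u | ENNReal.ofReal η ≤ ENNReal.ofReal |x u|} :=
    measure_mono fun u hu => ENNReal.ofReal_le_ofReal (le_of_lt hu)
  have h3 : ENNReal.ofReal (η * distribution x η) ≤ ENNReal.ofReal δ := by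
    rw [ENNReal.ofReal_mul hη.le, ofReal_distribution]
    exact (mul_le_mul_right h2 _).trans (h1.trans hle)
  rw [le_div_iff₀ hη, mul_comm]
  exact (ENNReal.ofReal_le_ofReal_iff hδ).1 h3

omit h in
theorem abs_clamp_sub_le (M u v : ℝ) :
    |max (-M) (min M u) - max (-M) (min M v)| ≤ |u - v| := by
  refine (abs_max_sub_max_le_max _ _ _ _).trans ?_
  rw [sub_self, abs_zero, max_eq_right (abs_nonneg _)]
  refine (abs_min_sub_min_le_max _ _ _ _).trans ?_
  rw [sub_self, abs_zero, max_eq_right (abs_nonneg _)]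

omit h in
theorem abs_clamp_le {M : ℝ} (hM : 0 ≤ M) (u : ℝ) : |max (-M) (min M u)| ≤ M :=
  abs_le.2 ⟨le_max_left _ _, max_le (by linarith) (min_le_left _ _)⟩

/-- Dyadic step functions of all sufficiently high levels approximate elements of the Lorentz
space. -/
theorem exists_dyadicSum_approx {x : ℝ → ℝ} (hxm : AEMeasurable x unitMeasure)
    (hx : lorentzNorm h.mono x < ∞) {ε : ℝ} (hε : 0 < ε) :
    ∃ k₀ : ℕ, ∀ k ≥ k₀, ∃ ξ : (Fin k → Fin 2) → ℝ,
      lorentzNorm h.mono (fun t => x t - dyadicSum ξ (fun _ => 1) t) ≤ ENNReal.ofReal ε := by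
  obtain ⟨M, hM, htr⟩ := h.exists_truncation hx (half_pos hε)
  set y : ℝ → ℝ := fun t => max (-M) (min M (x t)) with hy
  have hym : AEMeasurable y unitMeasure := aemeasurable_const.max (aemeasurable_const.min hxm)
  have hyb : ∀ t, |y t| ≤ M := fun t => abs_clamp_le hM.le _
  have hyi : Integrable y unitMeasure :=
    Integrable.of_bound hym.aestronglyMeasurable M (Eventually.of_forall hyb)
  obtain ⟨η, hη, hsmall⟩ := h.exists_lorentzNorm_le (2 * M) (half_pos hε)
  -- The `L¹` accuracy `η · (η/2)` makes `|y - g| > η/2` a set of measure at most `η` by Markov's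
  -- inequality; the other `η/2` is the oscillation of `g` on a dyadic interval. Clamping sampled
  -- values to `[-M, M]` keeps the error below `2M`, so smallness in measure suffices.
  obtain ⟨g, hgs, hgi, hgc, -⟩ := hyi.exists_hasCompactSupport_lintegral_sub_le
    (ε := ENNReal.ofReal (η * (η / 2))) (by simp; positivity)
  have hguc : UniformContinuous g := hgs.uniformContinuous_of_continuous hgc
  obtain ⟨δ, hδ, hg⟩ := Metric.uniformContinuous_iff.1 hguc (η / 2) (by positivity)
  obtain ⟨k₀, hk₀⟩ := exists_pow_lt_of_lt_one hδ (by norm_num : (1 / 2 : ℝ) < 1)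
  refine ⟨k₀, fun k hk => ?_⟩
  set ξ : (Fin k → Fin 2) → ℝ := fun a => max (-M) (min M (g (dyadicBranch k a 0))) with hξ
  refine ⟨ξ, ?_⟩
  set z : ℝ → ℝ := dyadicSum ξ fun _ => 1 with hz
  have hzm : AEMeasurable z unitMeasure := aemeasurable_dyadicSum ξ aemeasurable_const
  have hclose : ∀ᵐ t ∂unitMeasure, |z t - max (-M) (min M (g t))| ≤ η / 2 ∧ |z t| ≤ M := by
    refine (ae_unitMeasure_iff k).2 fun a => ?_
    filter_upwards [ae_unitMeasure_mem_Ioo] with t ht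
    rw [hz, dyadicSum_branch _ _ _ ht, mul_one]
    refine ⟨(abs_clamp_sub_le _ _ _).trans ?_, abs_clamp_le hM.le _⟩
    refine le_of_lt (hg ?_)
    rw [dyadicBranch_eq_add k a t, Real.dist_eq, sub_add_cancel_left, abs_neg,
      abs_of_nonneg (div_nonneg ht.1.le (by positivity))]
    calc t / 2 ^ k ≤ 1 / 2 ^ k := by gcongr; exact ht.2.le
      _ = (1 / 2) ^ k := by rw [div_pow, one_pow]
      _ ≤ (1 / 2) ^ k₀ := pow_le_pow_of_le_one (by norm_num) (by norm_num) hk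
      _ < δ := hk₀
  have hd1 : distribution (fun t => y t - g t) (η / 2) ≤ η := by
    have := distribution_le_of_lintegral_le (x := fun t => y t - g t) (δ := η * (η / 2))
      (hym.sub hgc.measurable.aemeasurable) (half_pos hη) (by positivity) (by
        simpa only [← ofReal_norm, Real.norm_eq_abs] using hgi)
    rwa [mul_div_cancel_right₀ _ (half_pos hη).ne'] at this
  have hd2 : distribution (fun t => y t - z t) η ≤ η := by
    refine le_trans ?_ hd1
    refine ENNReal.toReal_mono (measure_ne_top _ _) (measure_mono_ae ?_)
    filter_upwards [hclose] with t ht hlt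
    have h1 : η < |y t - z t| := hlt
    have h2 : |y t - z t| ≤ |y t - max (-M) (min M (g t))| + |z t - max (-M) (min M (g t))| := by
      rw [abs_sub_comm (z t)]
      exact abs_sub_le _ _ _
    have h3 : |y t - max (-M) (min M (g t))| ≤ |y t - g t| := by
      have h4 : y t = max (-M) (min M (y t)) := by
        rw [min_eq_right (abs_le.1 (hyb t)).2, max_eq_right (abs_le.1 (hyb t)).1]
      calc _ = |max (-M) (min M (y t)) - max (-M) (min M (g t))| := by rw [← h4]
        _ ≤ _ := abs_clamp_sub_le _ _ _
    change η / 2 < |y t - g t|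
    linarith [ht.1]
  have hs := hsmall (fun t => y t - z t) (by
    filter_upwards [hclose] with t ht
    linarith [abs_sub (y t) (z t), hyb t, ht.2]) hd2
  have hsplit : (fun t => x t - z t) = fun t => (x t - y t) + (y t - z t) := by ext t; ring
  rw [hsplit, ← ofReal_half_mul_two ε]
  exact (h.lorentzNorm_add_le (hxm.sub hym) (hym.sub hzm)).trans (add_le_add htr hs)

end IsLorentzWeight

/-! ### The weak law of large numbers for the doubling map. -/

/-- Birkhoff sums of a mean-zero dyadic step function of level `k` along the `k`-th power of the
doubling map. -/
def dyadicBirkhoff {k : ℕ} (η : (Fin k → Fin 2) → ℝ) (N : ℕ) (t : ℝ) : ℝ :=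
  ∑ n ∈ Finset.range N, dyadicDouble^[n * k] (dyadicSum η fun _ => 1) t

theorem aemeasurable_dyadicBirkhoff {k : ℕ} (η : (Fin k → Fin 2) → ℝ) (N : ℕ) :
    AEMeasurable (dyadicBirkhoff η N) unitMeasure :=
  Finset.aemeasurable_fun_sum _ fun _ _ =>
    aemeasurable_dyadicDouble_iterate _ (aemeasurable_dyadicSum _ aemeasurable_const)

/-- The first term sees only the first `k` binary digits, and the later terms only the remaining
ones: this is independence in recursive form. -/
theorem dyadicBirkhoff_branch {k : ℕ} (η : (Fin k → Fin 2) → ℝ) (N : ℕ) (a : Fin k → Fin 2) {t : ℝ}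
    (ht : t ∈ Ioo (0 : ℝ) 1) :
    dyadicBirkhoff η (N + 1) (dyadicBranch k a t) = η a + dyadicBirkhoff η N t := by
  unfold dyadicBirkhoff
  rw [Finset.sum_range_succ', add_comm]
  congr 1
  · rw [zero_mul, Function.iterate_zero, id, dyadicSum_branch _ _ _ ht, mul_one]
  · refine Finset.sum_congr rfl fun n _ => ?_
    rw [Nat.succ_mul, add_comm, Function.iterate_add_apply, dyadicDouble_iterate_branch _ _ _ ht]

theorem abs_dyadicBirkhoff_le {k : ℕ} {η : (Fin k → Fin 2) → ℝ} {B : ℝ} (hB : ∀ a, |η a| ≤ B)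
    (N : ℕ) : ∀ᵐ t ∂unitMeasure, |dyadicBirkhoff η N t| ≤ N * B := by
  induction N with
  | zero => simp [dyadicBirkhoff]
  | succ N ih =>
    refine (ae_unitMeasure_iff k).2 fun a => ?_
    filter_upwards [ih, ae_unitMeasure_mem_Ioo] with t h1 ht
    rw [dyadicBirkhoff_branch η N a ht]
    push_cast
    linarith [abs_add_le (η a) (dyadicBirkhoff η N t), hB a]

/-- Variances of independent terms add. In the recursion over branches the cross term carries the
factor `∑ η a`, which is zero. -/
theorem integral_dyadicBirkhoff_sq {k : ℕ} {η : (Fin k → Fin 2) → ℝ} (hη : ∑ a, η a = 0)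
    (N : ℕ) : Integrable (fun t => dyadicBirkhoff η N t ^ 2) unitMeasure ∧
      ∫ t, dyadicBirkhoff η N t ^ 2 ∂unitMeasure = N * ((2 ^ k)⁻¹ * ∑ a, η a ^ 2) := by
  obtain ⟨B, hB⟩ : ∃ B, ∀ a, |η a| ≤ B :=
    ⟨∑ a, |η a|, fun a => Finset.single_le_sum (fun b _ => abs_nonneg (η b)) (Finset.mem_univ a)⟩
  have hB0 : ∀ N : ℕ, Integrable (dyadicBirkhoff η N) unitMeasure := fun N =>
    Integrable.of_bound (aemeasurable_dyadicBirkhoff η N).aestronglyMeasurable (N * B)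
      (abs_dyadicBirkhoff_le hB N)
  have hint : ∀ N : ℕ, Integrable (fun t => dyadicBirkhoff η N t ^ 2) unitMeasure := by
    intro N
    refine Integrable.of_bound ((aemeasurable_dyadicBirkhoff η N).pow_const 2).aestronglyMeasurable
      ((N * B) ^ 2) ?_
    filter_upwards [abs_dyadicBirkhoff_le hB N] with t ht
    rw [Real.norm_eq_abs, abs_pow]
    gcongr
  refine ⟨hint N, ?_⟩
  induction N with
  | zero => simp [dyadicBirkhoff]
  | succ N ih =>
    rw [integral_unitMeasure_eq_sum k (hint (N + 1))]
    have hterm : ∀ a, ∫ t, dyadicBirkhoff η (N + 1) (dyadicBranch k a t) ^ 2 ∂unitMeasure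
        = η a ^ 2 + η a * (2 * ∫ t, dyadicBirkhoff η N t ∂unitMeasure)
          + ∫ t, dyadicBirkhoff η N t ^ 2 ∂unitMeasure := by
      intro a
      have : ∀ᵐ t ∂unitMeasure, dyadicBirkhoff η (N + 1) (dyadicBranch k a t) ^ 2
          = η a ^ 2 + η a * 2 * dyadicBirkhoff η N t + dyadicBirkhoff η N t ^ 2 := by
        filter_upwards [ae_unitMeasure_mem_Ioo] with t ht
        rw [dyadicBirkhoff_branch η N a ht]; ring
      have hlin : Integrable (fun t => η a ^ 2 + η a * 2 * dyadicBirkhoff η N t) unitMeasure :=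
        (integrable_const _).add ((hB0 N).const_mul _)
      rw [integral_congr_ae this, integral_add hlin (hint N), integral_add (integrable_const _) ((hB0 N).const_mul _), integral_const_mul]
      simp
      ring
    simp only [hterm, Finset.sum_add_distrib, ← Finset.sum_mul, hη, ih]
    simp only [Finset.sum_const, Finset.card_univ, Fintype.card_pi, Fintype.card_fin,
      Finset.prod_const, nsmul_eq_mul]
    push_cast
    field_simp
    ring

theorem integral_dyadicSum_one {k : ℕ} (ξ : (Fin k → Fin 2) → ℝ) :
    Integrable (dyadicSum ξ fun _ => 1) unitMeasure ∧
    ∫ t, dyadicSum ξ (fun _ => 1) t ∂unitMeasure = (2 ^ k)⁻¹ * ∑ a, ξ a := by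
  have hint : Integrable (dyadicSum ξ fun _ => 1) unitMeasure := by
    refine Integrable.of_bound
      (aemeasurable_dyadicSum ξ aemeasurable_const).aestronglyMeasurable (∑ a, |ξ a|) ?_
    refine (ae_unitMeasure_iff k).2 fun a => ?_
    filter_upwards [ae_unitMeasure_mem_Ioo] with t ht
    rw [dyadicSum_branch _ _ _ ht, mul_one]
    exact Finset.single_le_sum (f := fun a => |ξ a|) (fun b _ => abs_nonneg (ξ b))
      (Finset.mem_univ a)
  refine ⟨hint, ?_⟩
  rw [integral_unitMeasure_eq_sum k hint]
  congr 1
  refine Finset.sum_congr rfl fun a _ => ?_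
  rw [integral_congr_ae (g := fun _ => ξ a)]
  · simp
  · filter_upwards [ae_unitMeasure_mem_Ioo] with t ht
    rw [dyadicSum_branch _ _ _ ht, mul_one]

namespace IsLorentzWeight

variable {φ : ℝ → ℝ} (h : IsLorentzWeight φ)
include h

theorem abs_integral_le {x : ℝ → ℝ} (hxm : AEMeasurable x unitMeasure) :
    ENNReal.ofReal (φ 1 * |∫ t, x t ∂unitMeasure|) ≤ lorentzNorm h.mono x := by
  refine le_trans ?_ (h.lintegral_abs_le hxm)
  rw [ENNReal.ofReal_mul h.pos.le]
  gcongr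
  have := enorm_integral_le_lintegral_enorm (μ := unitMeasure) x
  simpa only [← ofReal_norm, Real.norm_eq_abs] using this

/-- Chebyshev's inequality makes the averages small in measure. They are uniformly bounded, so they
are also small in norm. -/
theorem exists_dyadicBirkhoff_small {k : ℕ} {η : (Fin k → Fin 2) → ℝ} (hη : ∑ a, η a = 0) {ε : ℝ}
    (hε : 0 < ε) : ∃ N : ℕ, 0 < N ∧
      lorentzNorm h.mono (fun t => (N : ℝ)⁻¹ * dyadicBirkhoff η N t) ≤ ENNReal.ofReal ε := by
  obtain ⟨B, hB⟩ : ∃ B, ∀ a, |η a| ≤ B :=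
    ⟨∑ a, |η a|, fun a => Finset.single_le_sum (fun b _ => abs_nonneg (η b)) (Finset.mem_univ a)⟩
  obtain ⟨δ, hδ, hsmall⟩ := h.exists_lorentzNorm_le B hε
  set v : ℝ := (2 ^ k)⁻¹ * ∑ a, η a ^ 2 with hv
  have hv0 : 0 ≤ v := mul_nonneg (by positivity) (Finset.sum_nonneg fun a _ => sq_nonneg _)
  -- Chebyshev's bound is `N v / (N δ)² = v / (N δ²)`, which is below `δ` for such `N`.
  obtain ⟨N, hN⟩ := exists_nat_gt (v / δ ^ 3)
  have hN0 : (0 : ℝ) < N := lt_of_le_of_lt (by positivity) hN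
  refine ⟨N, by exact_mod_cast hN0, hsmall _ ?_ ?_⟩
  · filter_upwards [abs_dyadicBirkhoff_le hB N] with t ht
    rw [abs_mul, abs_of_pos (inv_pos.2 hN0), inv_mul_le_iff₀ hN0]
    exact ht
  · obtain ⟨hint, hval⟩ := integral_dyadicBirkhoff_sq hη N
    have hcheb := mul_meas_ge_le_integral_of_nonneg
      (Eventually.of_forall fun t => sq_nonneg (dyadicBirkhoff η N t)) hint ((N * δ) ^ 2)
    rw [hval, ← hv] at hcheb
    have hsub : distribution (fun t => (N : ℝ)⁻¹ * dyadicBirkhoff η N t) δ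
        ≤ unitMeasure.real {t | (N * δ) ^ 2 ≤ dyadicBirkhoff η N t ^ 2} := by
      refine measureReal_mono fun t ht => ?_
      have h1 : δ < |(N : ℝ)⁻¹ * dyadicBirkhoff η N t| := ht
      rw [abs_mul, abs_of_pos (inv_pos.2 hN0), lt_inv_mul_iff₀ hN0] at h1
      change (N * δ) ^ 2 ≤ dyadicBirkhoff η N t ^ 2
      rw [← sq_abs (dyadicBirkhoff η N t)]
      gcongr
    refine hsub.trans ?_
    rw [div_lt_iff₀ (by positivity)] at hN
    have h2 : ((N : ℝ) * δ) ^ 2 * unitMeasure.real {t | (N * δ) ^ 2 ≤ dyadicBirkhoff η N t ^ 2}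
        ≤ (N * δ) ^ 2 * δ := by
      refine hcheb.trans ?_
      nlinarith
    exact le_of_mul_le_mul_left h2 (by positivity)

/-- Constants are limits of averages of `f ∘ 2ⁿ` (mod 1) when `f` has nonzero mean. -/
theorem exists_average_close_to_one {f : ℝ → ℝ} (hfm : AEMeasurable f unitMeasure)
    (hf : lorentzNorm h.mono f < ∞) (hI : ∫ t, f t ∂unitMeasure ≠ 0) {ε : ℝ} (hε : 0 < ε) :
    ∃ (T : Finset ℕ) (c : ℝ), lorentzNorm h.mono
      (fun t => 1 - c * ∑ m ∈ T, dyadicDouble^[m] f t) ≤ ENNReal.ofReal ε := by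
  set I := ∫ t, f t ∂unitMeasure with hIdef
  have hIpos : 0 < |I| := abs_pos.2 hI
  have hε' : 0 < ε * |I| / 4 := by positivity
  obtain ⟨k₀, hk₀⟩ := h.exists_dyadicSum_approx hfm hf hε'
  -- Positivity of `k` makes `n ↦ n * k` injective, so the exponents can be collected in a finite
  -- set.
  obtain ⟨k, hk, hkpos⟩ : ∃ k, k₀ ≤ k ∧ 0 < k := ⟨k₀ + 1, by omega, by omega⟩
  obtain ⟨ξ, hξ⟩ := hk₀ k hk
  set e : ℝ → ℝ := fun t => f t - dyadicSum ξ (fun _ => 1) t with he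
  have hem : AEMeasurable e unitMeasure :=
    hfm.sub (aemeasurable_dyadicSum ξ aemeasurable_const)
  set J : ℝ := (2 ^ k)⁻¹ * ∑ a, ξ a with hJ
  set η : (Fin k → Fin 2) → ℝ := fun a => ξ a - J with hη
  have hη0 : ∑ a, η a = 0 := by
    simp only [hη, Finset.sum_sub_distrib, Finset.sum_const, Finset.card_univ, Fintype.card_pi,
      Fintype.card_fin, Finset.prod_const, nsmul_eq_mul, hJ]
    push_cast
    field_simp
    ring
  obtain ⟨N, hN, hsmall⟩ := h.exists_dyadicBirkhoff_small hη0 (ε := ε * |I| / 2) (by positivity)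
  have hN0 : (0 : ℝ) < N := Nat.cast_pos.2 hN
  have hIJ : φ 1 * |I - J| ≤ ε * |I| / 4 := by
    have h1 := (h.abs_integral_le hem).trans hξ
    obtain ⟨hsi, hsv⟩ := integral_dyadicSum_one ξ
    rw [he, integral_sub (h.integrable_of_lorentzNorm_lt_top hfm hf) hsi, hsv] at h1
    exact (ENNReal.ofReal_le_ofReal_iff hε'.le).1 h1
  refine ⟨(Finset.range N).image fun n => n * k, (N * I)⁻¹, ?_⟩
  have hsum : ∀ t, ∑ m ∈ (Finset.range N).image (fun n => n * k), dyadicDouble^[m] f t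
      = ∑ n ∈ Finset.range N, dyadicDouble^[n * k] f t := fun t =>
    Finset.sum_image fun m _ n _ hmn => Nat.eq_of_mul_eq_mul_right hkpos hmn
  have hpt : ∀ᵐ t ∂unitMeasure, ∀ n : ℕ, dyadicDouble^[n * k] f t
      = dyadicDouble^[n * k] e t + J + dyadicDouble^[n * k] (dyadicSum η fun _ => 1) t := by
    refine ae_all_iff.2 fun n => (ae_unitMeasure_iff (n * k)).2 fun a => ?_
    have hη' : ∀ᵐ t ∂unitMeasure, f t = e t + J + dyadicSum η (fun _ => 1) t := by
      refine (ae_unitMeasure_iff k).2 fun b => ?_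
      filter_upwards [ae_unitMeasure_mem_Ioo] with t ht
      simp only [he, dyadicSum_branch _ _ _ ht, hη]
      ring
    filter_upwards [hη', ae_unitMeasure_mem_Ioo] with t h1 ht
    simp only [dyadicDouble_iterate_branch _ _ _ ht]
    exact h1
  -- Three errors: the means of `f` and of the step function differ; the approximation error `e` is
  -- averaged over equimeasurable copies; the centred step function is handled by the weak law.
  -- Their bounds, `1/4`, `1/4` and `1/2` of `ε |I|`, are then divided by `|I|`.
  have hdec : ∀ᵐ t ∂unitMeasure,
      1 - (N * I)⁻¹ * ∑ m ∈ (Finset.range N).image (fun n => n * k), dyadicDouble^[m] f t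
      = I⁻¹ * ((I - J) * 1 + ((N : ℝ)⁻¹ * ∑ n ∈ Finset.range N, -dyadicDouble^[n * k] e t
        + -((N : ℝ)⁻¹ * dyadicBirkhoff η N t))) := by
    filter_upwards [hpt] with t ht
    simp only [hsum, ht, Finset.sum_add_distrib, Finset.sum_const, Finset.card_range, nsmul_eq_mul,
      Finset.sum_neg_distrib, dyadicBirkhoff]
    field_simp
    ring
  have hPm : ∀ n, AEMeasurable (fun t => -dyadicDouble^[n * k] e t) unitMeasure := fun n =>
    (aemeasurable_dyadicDouble_iterate _ hem).neg
  have hSm : AEMeasurable (fun t => ∑ n ∈ Finset.range N, -dyadicDouble^[n * k] e t)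
      unitMeasure := Finset.aemeasurable_fun_sum _ fun n _ => hPm n
  have hBm := aemeasurable_dyadicBirkhoff η N
  rw [h.lorentzNorm_congr (hdec.mono fun t ht => congrArg abs ht), h.lorentzNorm_const_mul]
  have h1 : lorentzNorm h.mono (fun t => (I - J) * 1) ≤ ENNReal.ofReal (ε * |I| / 4) := by
    rw [h.lorentzNorm_const_mul, h.lorentzNorm_one, ← ENNReal.ofReal_mul (abs_nonneg _), mul_comm]
    exact ENNReal.ofReal_le_ofReal hIJ
  have h2 : lorentzNorm h.mono
      (fun t => (N : ℝ)⁻¹ * ∑ n ∈ Finset.range N, -dyadicDouble^[n * k] e t)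
      ≤ ENNReal.ofReal (ε * |I| / 4) := by
    rw [h.lorentzNorm_const_mul]
    calc _ ≤ ENNReal.ofReal |(N : ℝ)⁻¹| * ∑ n ∈ Finset.range N, lorentzNorm h.mono e := by
          gcongr
          refine (h.lorentzNorm_sum_le _ fun n _ => hPm n).trans (le_of_eq ?_)
          refine Finset.sum_congr rfl fun n _ => ?_
          rw [h.lorentzNorm_neg, h.lorentzNorm_dyadicDouble_iterate]
      _ = lorentzNorm h.mono e := by
          rw [Finset.sum_const, Finset.card_range, nsmul_eq_mul, ← mul_assoc,
            ← ENNReal.ofReal_natCast, ← ENNReal.ofReal_mul (abs_nonneg _),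
            abs_of_pos (inv_pos.2 hN0), inv_mul_cancel₀ hN0.ne', ENNReal.ofReal_one, one_mul]
      _ ≤ _ := hξ
  have h3 : lorentzNorm h.mono (fun t => -((N : ℝ)⁻¹ * dyadicBirkhoff η N t))
      ≤ ENNReal.ofReal (ε * |I| / 2) := by
    rw [h.lorentzNorm_neg]; exact hsmall
  calc _ ≤ ENNReal.ofReal |I⁻¹| * (ENNReal.ofReal (ε * |I| / 4)
          + (ENNReal.ofReal (ε * |I| / 4) + ENNReal.ofReal (ε * |I| / 2))) := by
        gcongr
        refine (h.lorentzNorm_add_le aemeasurable_const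
          ((hSm.const_mul _).add (hBm.const_mul _).neg)).trans (add_le_add h1 ?_)
        exact (h.lorentzNorm_add_le (hSm.const_mul _) (hBm.const_mul _).neg).trans
          (add_le_add h2 h3)
    _ = ENNReal.ofReal ε := by
        rw [← ENNReal.ofReal_add (by positivity) (by positivity),
          ← ENNReal.ofReal_add (by positivity) (by positivity),
          ← ENNReal.ofReal_mul (abs_nonneg _), abs_inv]
        congr 1
        field_simp
        ring

end IsLorentzWeight

/-! ### Sufficiency: iterated approximation and convergence of the series. -/

/-- The part of level `j` of the formal series `∑ ξ_α V^α f`. -/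
def dyadicLevel (ξ : DyadicIndex → ℝ) (f : ℝ → ℝ) (j : ℕ) : ℝ → ℝ :=
  dyadicSum (fun b : Fin j → Fin 2 => ξ ⟨j, b⟩) f

theorem aemeasurable_dyadicLevel (ξ : DyadicIndex → ℝ) {f : ℝ → ℝ}
    (hf : AEMeasurable f unitMeasure) (j : ℕ) : AEMeasurable (dyadicLevel ξ f j) unitMeasure :=
  aemeasurable_dyadicSum _ hf

theorem aemeasurable_sum_dyadicLevel (ξ : DyadicIndex → ℝ) {f : ℝ → ℝ}
    (hf : AEMeasurable f unitMeasure) (S : Finset ℕ) :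
    AEMeasurable (fun t => ∑ j ∈ S, dyadicLevel ξ f j t) unitMeasure :=
  Finset.aemeasurable_fun_sum _ fun j _ => aemeasurable_dyadicLevel ξ hf j

theorem dyadicLevel_eq_zero {ξ : DyadicIndex → ℝ} {j : ℕ} (hξ : ∀ b : Fin j → Fin 2, ξ ⟨j, b⟩ = 0)
    (f : ℝ → ℝ) : dyadicLevel ξ f j = fun _ => 0 := by
  ext t; simp [dyadicLevel, dyadicSum, hξ]

theorem dyadicLevel_congr {ξ ζ : DyadicIndex → ℝ} {j : ℕ}
    (hξ : ∀ b : Fin j → Fin 2, ξ ⟨j, b⟩ = ζ ⟨j, b⟩) (f : ℝ → ℝ) :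
    dyadicLevel ξ f j = dyadicLevel ζ f j := by
  ext t; simp [dyadicLevel, dyadicSum, hξ]

namespace IsLorentzWeight

variable {φ : ℝ → ℝ} (h : IsLorentzWeight φ)
include h

/-- One approximation step: half of the norm of `x` is removed by a combination of the `V^α f` with
levels in a window starting above a prescribed bound. -/
theorem exists_window {C : ℝ} (hC : 0 < C)
    (hsub : ∀ s ∈ Icc (0 : ℝ) 1, ∀ t ∈ Icc (0 : ℝ) 1, φ (s * t) ≤ C * φ s * φ t)
    {f : ℝ → ℝ} (hfm : AEMeasurable f unitMeasure) (hf : lorentzNorm h.mono f < ∞)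
    (hI : ∫ t, f t ∂unitMeasure ≠ 0) :
    ∃ D : ℝ≥0∞, D ≠ ∞ ∧ ∀ x : ℝ → ℝ, AEMeasurable x unitMeasure → lorentzNorm h.mono x < ∞ →
      ∀ n : ℕ, ∃ (n' : ℕ) (ζ : DyadicIndex → ℝ), n < n' ∧ (∀ α : DyadicIndex, α.1 < n → ζ α = 0) ∧
        lorentzNorm h.mono (fun t => x t - ∑ j ∈ Finset.range n', dyadicLevel ζ f j t)
          ≤ lorentzNorm h.mono x / 2 ∧
        ∑ j ∈ Finset.range n', lorentzNorm h.mono (dyadicLevel ζ f j)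
          ≤ D * lorentzNorm h.mono x := by
  -- The tolerance is set so that `C · 2‖x‖ · 1/(8C) = ‖x‖/4`, which with an approximation error
  -- `‖x‖/4` leaves half of the norm. `T` and `c` are fixed before `x`, so the cost factor `D` is
  -- uniform.
  obtain ⟨T, c, hTc⟩ := h.exists_average_close_to_one hfm hf hI (ε := 1 / (8 * C)) (by positivity)
  refine ⟨T.card * (ENNReal.ofReal |c| * (ENNReal.ofReal (2 * C) * lorentzNorm h.mono f)),
    ENNReal.mul_ne_top (by simp) (ENNReal.mul_ne_top ENNReal.ofReal_ne_top
      (ENNReal.mul_ne_top ENNReal.ofReal_ne_top hf.ne)),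
    fun x hxm hx n => ?_⟩
  rcases eq_or_ne (lorentzNorm h.mono x) 0 with hx0 | hx0
  · refine ⟨n + 1, fun _ => 0, Nat.lt_succ_self n, fun _ _ => rfl, ?_, ?_⟩
    · simp [dyadicLevel_eq_zero, hx0]
    · simp [dyadicLevel_eq_zero, h.lorentzNorm_zero]
  set ℓ := (lorentzNorm h.mono x).toReal with hℓ
  have hℓ0 : 0 < ℓ := ENNReal.toReal_pos hx0 hx.ne
  have hxℓ : lorentzNorm h.mono x = ENNReal.ofReal ℓ := (ENNReal.ofReal_toReal hx.ne).symm
  obtain ⟨k₀, hk₀⟩ := h.exists_dyadicSum_approx hxm hx (ε := ℓ / 4) (by positivity)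
  obtain ⟨k, hk, hkn⟩ : ∃ k, k₀ ≤ k ∧ n ≤ k := ⟨max k₀ n, le_max_left _ _, le_max_right _ _⟩
  obtain ⟨ξ, hξ⟩ := hk₀ k hk
  set P := T.sup id + 1 with hP
  have hTP : T ⊆ Finset.range P := fun m hm =>
    Finset.mem_range.2 (Nat.lt_succ_of_le (Finset.le_sup (f := id) hm))
  -- For `m ∈ T`, level `k + m` carries `c ξ` read on the first `k` digits, that is, `c ξ` times the
  -- copy of `f` doubled `k + m` times. All levels below `k ≥ n` are empty.
  set ζ : DyadicIndex → ℝ := fun α =>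
    if hα : k ≤ α.1 then if α.1 - k ∈ T then c * ξ fun i => α.2 (Fin.castLE hα i) else 0 else 0
    with hζ
  have hlow : ∀ j < k, dyadicLevel ζ f j = fun _ => 0 := fun j hj =>
    dyadicLevel_eq_zero (fun b => dif_neg (not_le.2 hj)) f
  have hhigh : ∀ m, dyadicLevel ζ f (k + m)
      = if m ∈ T then fun t => c * dyadicSum ξ (dyadicDouble^[m] f) t else fun _ => 0 := by
    intro m
    split_ifs with hm
    · rw [dyadicSum_dyadicDouble_iterate]
      ext t
      simp only [dyadicLevel, dyadicSum, Finset.mul_sum]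
      refine Finset.sum_congr rfl fun b _ => ?_
      simp only [hζ, Nat.le_add_right, dif_pos, Nat.add_sub_cancel_left, hm, if_true, mul_assoc]
      rfl
    · refine dyadicLevel_eq_zero (fun b => ?_) f
      simp only [hζ, Nat.le_add_right, dif_pos, Nat.add_sub_cancel_left, hm, if_false]
  have hsum : ∀ {M : Type} [AddCommMonoid M] (G : (ℝ → ℝ) → M), G (fun _ => 0) = 0 →
      ∑ j ∈ Finset.range (k + P), G (dyadicLevel ζ f j)
        = ∑ m ∈ T, G fun t => c * dyadicSum ξ (dyadicDouble^[m] f) t := by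
    intro M _ G hG
    rw [Finset.sum_range_add, Finset.sum_eq_zero fun j hj => by
      rw [hlow j (Finset.mem_range.1 hj), hG], zero_add, ← Finset.sum_subset hTP]
    · exact Finset.sum_congr rfl fun m hm => by rw [hhigh, if_pos hm]
    · intro m _ hm
      rw [hhigh, if_neg hm, hG]
  have hPm : ∀ m, AEMeasurable (dyadicDouble^[m] f) unitMeasure := fun m =>
    aemeasurable_dyadicDouble_iterate m hfm
  have hone : AEMeasurable (dyadicSum ξ fun _ => 1) unitMeasure :=
    aemeasurable_dyadicSum ξ aemeasurable_const
  have hξ2 : lorentzNorm h.mono (dyadicSum ξ fun _ => 1) ≤ ENNReal.ofReal (2 * ℓ) := by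
    have : dyadicSum ξ (fun _ => 1)
        = fun t => x t - (x t - dyadicSum ξ (fun _ => 1) t) := by ext t; ring
    rw [this]
    refine (h.lorentzNorm_sub_le hxm (hxm.sub hone)).trans ?_
    rw [hxℓ]
    refine (add_le_add_right hξ _).trans ?_
    rw [← ENNReal.ofReal_add (by positivity) (by positivity)]
    exact ENNReal.ofReal_le_ofReal (by linarith)
  refine ⟨k + P, ζ, by omega, fun α hα => ?_, ?_, ?_⟩
  · exact dif_neg (by omega)
  · set g : ℝ → ℝ := fun t => 1 - c * ∑ m ∈ T, dyadicDouble^[m] f t with hg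
    have hgm : AEMeasurable g unitMeasure :=
      aemeasurable_const.sub ((Finset.aemeasurable_fun_sum _ fun m _ => hPm m).const_mul c)
    -- The step function approximates `x`, and `g` measures how far the average of copies of `f` is
    -- from `1`; the second error is itself a tensor product.
    have hdec : ∀ᵐ t ∂unitMeasure, x t - ∑ j ∈ Finset.range (k + P), dyadicLevel ζ f j t
        = (x t - dyadicSum ξ (fun _ => 1) t) + dyadicSum ξ g t := by
      refine (ae_unitMeasure_iff k).2 fun a => ?_
      filter_upwards [ae_unitMeasure_mem_Ioo] with t ht
      rw [hsum (fun F => F (dyadicBranch k a t)) rfl]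
      simp only [dyadicSum_branch _ _ _ ht, hg, ← Finset.mul_sum]
      ring
    rw [h.lorentzNorm_congr (hdec.mono fun t ht => congrArg abs ht)]
    refine (h.lorentzNorm_add_le (hxm.sub hone) (aemeasurable_dyadicSum ξ hgm)).trans ?_
    calc _ ≤ ENNReal.ofReal (ℓ / 4)
          + ENNReal.ofReal C * ENNReal.ofReal (2 * ℓ) * ENNReal.ofReal (1 / (8 * C)) := by
          refine _root_.add_le_add hξ ((h.lorentzNorm_dyadicSum_le hC hsub ξ hgm).trans ?_)
          gcongr
      _ = ENNReal.ofReal (ℓ / 2) := by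
          rw [← ENNReal.ofReal_mul hC.le, ← ENNReal.ofReal_mul (by positivity),
            ← ENNReal.ofReal_add (by positivity) (by positivity)]
          congr 1
          field_simp
          ring
      _ = _ := by rw [hxℓ, ENNReal.ofReal_div_of_pos two_pos, ENNReal.ofReal_ofNat]
  · rw [hsum _ h.lorentzNorm_zero]
    calc _ ≤ ∑ m ∈ T, ENNReal.ofReal |c| * (ENNReal.ofReal (2 * C) * lorentzNorm h.mono f)
            * lorentzNorm h.mono x := by
          refine Finset.sum_le_sum fun m _ => ?_
          rw [h.lorentzNorm_const_mul, mul_assoc]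
          gcongr
          refine (h.lorentzNorm_dyadicSum_le hC hsub ξ (hPm m)).trans ?_
          rw [h.lorentzNorm_dyadicDouble_iterate, hxℓ]
          calc _ ≤ ENNReal.ofReal C * ENNReal.ofReal (2 * ℓ) * lorentzNorm h.mono f := by gcongr
            _ = _ := by
                rw [← ENNReal.ofReal_mul hC.le, mul_right_comm (ENNReal.ofReal (2 * C)),
                  ← ENNReal.ofReal_mul (by positivity)]
                congr 2
                ring
      _ = _ := by rw [Finset.sum_const, nsmul_eq_mul, ← mul_assoc]

/-- Iterating the approximation step. -/
theorem exists_coefficients {f : ℝ → ℝ} (hfm : AEMeasurable f unitMeasure) {D : ℝ≥0∞}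
    (hD : ∀ x : ℝ → ℝ, AEMeasurable x unitMeasure → lorentzNorm h.mono x < ∞ →
      ∀ n : ℕ, ∃ (n' : ℕ) (ζ : DyadicIndex → ℝ), n < n' ∧ (∀ α : DyadicIndex, α.1 < n → ζ α = 0) ∧
        lorentzNorm h.mono (fun t => x t - ∑ j ∈ Finset.range n', dyadicLevel ζ f j t)
          ≤ lorentzNorm h.mono x / 2 ∧
        ∑ j ∈ Finset.range n', lorentzNorm h.mono (dyadicLevel ζ f j)
          ≤ D * lorentzNorm h.mono x)
    {x : ℝ → ℝ} (hxm : AEMeasurable x unitMeasure) (hx : lorentzNorm h.mono x < ∞) :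
    ∃ (ξ : DyadicIndex → ℝ) (n : ℕ → ℕ), StrictMono n ∧
      (∀ i, lorentzNorm h.mono (fun t => x t - ∑ j ∈ Finset.range (n i), dyadicLevel ξ f j t)
        ≤ (2⁻¹) ^ i * lorentzNorm h.mono x) ∧
      ∑' j, lorentzNorm h.mono (dyadicLevel ξ f j) ≤ D * 2 * lorentzNorm h.mono x := by
  let res : ℕ × (DyadicIndex → ℝ) → ℝ → ℝ := fun s t =>
    x t - ∑ j ∈ Finset.range s.1, dyadicLevel s.2 f j t
  let cost : ℕ × (DyadicIndex → ℝ) → ℝ≥0∞ := fun s =>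
    ∑ j ∈ Finset.range s.1, lorentzNorm h.mono (dyadicLevel s.2 f j)
  have hresm : ∀ s, AEMeasurable (res s) unitMeasure := fun s =>
    hxm.sub (aemeasurable_sum_dyadicLevel _ hfm _)
  -- A state is a level bound together with coefficients. The new window lies at or above the old
  -- bound, so earlier coefficients are kept. Finiteness is a premise inside the existential so that
  -- `choose` gives a step defined on all states.
  have hstep : ∀ s : ℕ × (DyadicIndex → ℝ), ∃ s' : ℕ × (DyadicIndex → ℝ),
      lorentzNorm h.mono (res s) < ∞ → s.1 < s'.1 ∧
        (∀ α : DyadicIndex, α.1 < s.1 → s'.2 α = s.2 α) ∧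
        lorentzNorm h.mono (res s') ≤ lorentzNorm h.mono (res s) / 2 ∧
        cost s' ≤ cost s + D * lorentzNorm h.mono (res s) := by
    intro s
    by_cases hs : lorentzNorm h.mono (res s) < ∞
    swap
    · exact ⟨s, fun h' => absurd h' hs⟩
    obtain ⟨n', ζ, hn, hlow, hle, hcost⟩ := hD (res s) (hresm s) hs s.1
    let c : DyadicIndex → ℝ := fun α => if α.1 < s.1 then s.2 α else ζ α
    have hc1 : ∀ j < s.1, dyadicLevel c f j = dyadicLevel s.2 f j := fun j hj =>
      dyadicLevel_congr (fun b => if_pos hj) f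
    have hc2 : ∀ j, s.1 ≤ j → dyadicLevel c f j = dyadicLevel ζ f j := fun j hj =>
      dyadicLevel_congr (fun b => if_neg (not_lt.2 hj)) f
    have hz : ∀ j < s.1, dyadicLevel ζ f j = fun _ => 0 := fun j hj =>
      dyadicLevel_eq_zero (fun b => hlow _ hj) f
    obtain ⟨d, rfl⟩ := Nat.exists_eq_add_of_le hn.le
    have hsplit : ∀ {M : Type} [AddCommMonoid M] (G : (ℝ → ℝ) → M), G (fun _ => 0) = 0 →
        ∑ j ∈ Finset.range (s.1 + d), G (dyadicLevel c f j)
          = ∑ j ∈ Finset.range s.1, G (dyadicLevel s.2 f j)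
            + ∑ j ∈ Finset.range (s.1 + d), G (dyadicLevel ζ f j) := by
      intro M _ G hG
      rw [Finset.sum_range_add, Finset.sum_range_add (fun j => G (dyadicLevel ζ f j)),
        Finset.sum_eq_zero (s := Finset.range s.1) (f := fun j => G (dyadicLevel ζ f j))
          fun j hj => by rw [hz j (Finset.mem_range.1 hj), hG], zero_add]
      congr 1
      · exact Finset.sum_congr rfl fun j hj => by rw [hc1 j (Finset.mem_range.1 hj)]
      · exact Finset.sum_congr rfl fun j _ => by rw [hc2 _ (Nat.le_add_right _ _)]
    refine ⟨(s.1 + d, c), fun _ => ⟨hn, fun α hα => if_pos hα, ?_, ?_⟩⟩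
    · have : res (s.1 + d, c)
          = fun t => res s t - ∑ j ∈ Finset.range (s.1 + d), dyadicLevel ζ f j t := by
        ext t
        simp only [res]
        rw [hsplit (fun F => F t) rfl]
        ring
      rw [this]
      exact hle
    · simp only [cost]
      rw [hsplit _ h.lorentzNorm_zero]
      exact add_le_add_right hcost _
  choose next hnext using hstep
  let σ : ℕ → ℕ × (DyadicIndex → ℝ) := fun i => next^[i] (0, fun _ => 0)
  have hσ : ∀ i, σ (i + 1) = next (σ i) := fun i => Function.iterate_succ_apply' _ _ _
  have hres : ∀ i, lorentzNorm h.mono (res (σ i)) ≤ (2⁻¹) ^ i * lorentzNorm h.mono x := by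
    intro i
    induction i with
    | zero => simp [σ, res]
    | succ i ih =>
      have hfin : lorentzNorm h.mono (res (σ i)) < ∞ :=
        ih.trans_lt (ENNReal.mul_lt_top (by simp) hx)
      rw [hσ, pow_succ, mul_right_comm, ← div_eq_mul_inv]
      exact (hnext _ hfin).2.2.1.trans (ENNReal.div_le_div_right ih 2)
  have hfin : ∀ i, lorentzNorm h.mono (res (σ i)) < ∞ := fun i =>
    (hres i).trans_lt (ENNReal.mul_lt_top (by simp) hx)
  have hcost : ∀ i, cost (σ i)
      ≤ D * ((∑ q ∈ Finset.range i, (2⁻¹ : ℝ≥0∞) ^ q) * lorentzNorm h.mono x) := by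
    intro i
    induction i with
    | zero => simp [σ, cost]
    | succ i ih =>
      rw [hσ, Finset.sum_range_succ, add_mul, mul_add]
      refine (hnext _ (hfin i)).2.2.2.trans (_root_.add_le_add ih ?_)
      gcongr
      exact hres i
  have hmono : StrictMono fun i => (σ i).1 := strictMono_nat_of_lt_succ fun i => by
    rw [hσ]; exact (hnext _ (hfin i)).1
  have hagree : ∀ i i', i ≤ i' → ∀ α : DyadicIndex, α.1 < (σ i).1 → (σ i').2 α = (σ i).2 α := by
    intro i i' hii'
    induction i', hii' using Nat.le_induction with
    | base => exact fun _ _ => rfl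
    | succ m hm ih =>
      intro α hα
      rw [hσ, (hnext _ (hfin m)).2.1 α (hα.trans_le (hmono.monotone hm)), ih α hα]
  -- The level bounds increase strictly from `0`, so after `|α| + 1` stages the coefficient at `α`
  -- is final.
  let ξ : DyadicIndex → ℝ := fun α => (σ (α.1 + 1)).2 α
  have hξ : ∀ i, ∀ α : DyadicIndex, α.1 < (σ i).1 → ξ α = (σ i).2 α := by
    intro i α hα
    have hα' : α.1 < (σ (α.1 + 1)).1 := (Nat.lt_succ_self _).trans_le hmono.le_apply
    rcases le_total i (α.1 + 1) with hi | hi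
    · exact hagree _ _ hi α hα
    · exact (hagree _ _ hi α hα').symm
  have hlev : ∀ i, ∀ j < (σ i).1, dyadicLevel ξ f j = dyadicLevel (σ i).2 f j := fun i j hj =>
    dyadicLevel_congr (fun b => hξ i _ hj) f
  refine ⟨ξ, fun i => (σ i).1, hmono, fun i => ?_, ENNReal.tsum_le_of_sum_range_le fun n => ?_⟩
  · refine le_trans (le_of_eq ?_) (hres i)
    congr 1
    ext t
    simp only [res]
    congr 1
    exact Finset.sum_congr rfl fun j hj => by rw [hlev i j (Finset.mem_range.1 hj)]
  · calc ∑ j ∈ Finset.range n, lorentzNorm h.mono (dyadicLevel ξ f j)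
        ≤ ∑ j ∈ Finset.range (σ n).1, lorentzNorm h.mono (dyadicLevel ξ f j) :=
          Finset.sum_le_sum_of_subset (Finset.range_mono hmono.le_apply)
      _ = cost (σ n) := Finset.sum_congr rfl fun j hj => by
          rw [hlev n j (Finset.mem_range.1 hj)]
      _ ≤ D * ((∑ q ∈ Finset.range n, (2⁻¹ : ℝ≥0∞) ^ q) * lorentzNorm h.mono x) := hcost n
      _ ≤ D * (2 * lorentzNorm h.mono x) := by
          gcongr
          refine (ENNReal.sum_le_tsum _).trans (le_of_eq ?_)
          rw [ENNReal.tsum_geometric, ENNReal.one_sub_inv_two, inv_inv]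
      _ = _ := (mul_assoc _ _ _).symm

/-- Summability of the norms of the levels upgrades convergence along levels to unconditional
convergence. -/
theorem tendsto_lorentzNorm_sub_sum {f : ℝ → ℝ} (hfm : AEMeasurable f unitMeasure) {x : ℝ → ℝ}
    (hxm : AEMeasurable x unitMeasure) {ξ : DyadicIndex → ℝ} {n : ℕ → ℕ} (hn : StrictMono n)
    (hres : Tendsto (fun i => lorentzNorm h.mono
      (fun t => x t - ∑ j ∈ Finset.range (n i), dyadicLevel ξ f j t)) atTop (𝓝 0))
    (hsum : ∑' j, lorentzNorm h.mono (dyadicLevel ξ f j) ≠ ∞) :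
    Tendsto (fun F : Finset DyadicIndex =>
      lorentzNorm h.mono (fun t => x t - ∑ α ∈ F, ξ α * dyadicV α f t)) atTop (𝓝 0) := by
  classical
  set w : ℕ → ℝ≥0∞ := fun j => lorentzNorm h.mono (dyadicLevel ξ f j) with hw
  have htail : Tendsto (fun i => ∑' j, w (j + n i)) atTop (𝓝 0) :=
    (ENNReal.tendsto_sum_nat_add w hsum).comp hn.tendsto_atTop
  have hboth := hres.add htail
  rw [add_zero] at hboth
  rw [ENNReal.tendsto_nhds_zero] at hboth ⊢
  intro ε hε
  obtain ⟨i, hi⟩ := (hboth ε hε).exists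
  filter_upwards [eventually_ge_atTop (shortIndices (n i))] with F hF
  refine le_trans ?_ hi
  -- Outside the first `n i` levels, `F` selects an arbitrary part of each level. The terms of a
  -- level are disjointly supported almost everywhere, so dropping some does not increase its norm,
  -- and the tail of the level norms bounds the excess.
  set G := F \ shortIndices (n i) with hG
  obtain ⟨J, hJ⟩ : ∃ J, G ⊆ shortIndices J := by
    refine ⟨G.sup (fun α => α.1) + 1, fun α hα => mem_shortIndices.2 ?_⟩
    exact Nat.lt_succ_of_le (Finset.le_sup (f := fun α : DyadicIndex => α.1) hα)
  let ζ : DyadicIndex → ℝ := fun α => if α ∈ G then ξ α else 0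
  have hsumG : ∀ t, ∑ α ∈ G, ξ α * dyadicV α f t = ∑ j ∈ Finset.range J, dyadicLevel ζ f j t := by
    intro t
    rw [Finset.sum_subset_zero_on_sdiff (g := fun α => ζ α * dyadicV α f t) hJ]
    · exact sum_shortIndices ζ f J t
    · intro α hα
      simp [ζ, (Finset.mem_sdiff.1 hα).2]
    · intro α hα
      simp [ζ, hα]
  have hdec : (fun t => x t - ∑ α ∈ F, ξ α * dyadicV α f t)
      = fun t => (x t - ∑ j ∈ Finset.range (n i), dyadicLevel ξ f j t)
        - ∑ j ∈ Finset.range J, dyadicLevel ζ f j t := by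
    ext t
    rw [← hsumG, ← Finset.sum_sdiff hF, sum_shortIndices]
    simp only [hG, dyadicLevel]
    ring
  rw [hdec]
  refine (h.lorentzNorm_sub_le (hxm.sub (aemeasurable_sum_dyadicLevel _ hfm _))
    (aemeasurable_sum_dyadicLevel _ hfm _)).trans (add_le_add_right ?_ _)
  refine (h.lorentzNorm_sum_le _ fun j _ => aemeasurable_dyadicLevel ζ hfm j).trans ?_
  have hlow : ∀ j < n i, lorentzNorm h.mono (dyadicLevel ζ f j) = 0 := by
    intro j hj
    have hz : ∀ b : Fin j → Fin 2, ζ ⟨j, b⟩ = 0 := fun b =>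
      if_neg fun hb => (Finset.mem_sdiff.1 hb).2 (mem_shortIndices.2 hj)
    rw [dyadicLevel_eq_zero hz f, h.lorentzNorm_zero]
  have hle : ∀ j, lorentzNorm h.mono (dyadicLevel ζ f j) ≤ w j := by
    intro j
    refine h.lorentzNorm_dyadicSum_mono (fun b => ?_) f
    simp only [ζ]
    split_ifs
    · exact le_rfl
    · rw [abs_zero]; exact abs_nonneg _
  calc ∑ j ∈ Finset.range J, lorentzNorm h.mono (dyadicLevel ζ f j)
      ≤ ∑ j ∈ Finset.range (n i + J), lorentzNorm h.mono (dyadicLevel ζ f j) :=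
        Finset.sum_le_sum_of_subset (Finset.range_mono (Nat.le_add_left _ _))
    _ = ∑ j ∈ Finset.range J, lorentzNorm h.mono (dyadicLevel ζ f (n i + j)) := by
        rw [Finset.sum_range_add, Finset.sum_eq_zero fun j hj => hlow j (Finset.mem_range.1 hj),
          zero_add]
    _ ≤ ∑ j ∈ Finset.range J, w (j + n i) :=
        Finset.sum_le_sum fun j _ => by rw [add_comm]; exact hle _
    _ ≤ _ := ENNReal.sum_le_tsum _

theorem representing_of_isSubmultiplicative (hφ : IsSubmultiplicative φ) {f : ℝ → ℝ}
    (hf : MemLorentz h.mono f) (hI : (∫ t in (0 : ℝ)..1, f t) ≠ 0) :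
    IsAbsolutelyRepresentingSystem h.mono f := by
  obtain ⟨C, hC, hsub⟩ := hφ
  obtain ⟨hfm, hffin⟩ := hf
  rw [intervalIntegral.integral_of_le zero_le_one, ← integral_Icc_eq_integral_Ioc] at hI
  obtain ⟨D, hDfin, hD⟩ := h.exists_window hC hsub hfm hffin hI
  -- The summand `1` only makes the constant positive, as `D` may vanish.
  refine ⟨(D * 2).toReal + 1, by positivity, fun x hx => ?_⟩
  obtain ⟨ξ, n, hn, hres, hsum⟩ := h.exists_coefficients hfm hD hx.1 hx.2
  have hD2 : D * 2 ≠ ∞ := ENNReal.mul_ne_top hDfin (by simp)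
  refine ⟨ξ, h.tendsto_lorentzNorm_sub_sum hfm hx.1 hn ?_ ?_, hsum.trans ?_⟩
  · refine tendsto_of_tendsto_of_tendsto_of_le_of_le tendsto_const_nhds ?_ (fun _ => zero_le) hres
    have := ENNReal.Tendsto.mul_const (b := lorentzNorm h.mono x)
      (ENNReal.tendsto_pow_atTop_nhds_zero_of_lt_one (r := 2⁻¹) (by simp)) (Or.inr hx.2.ne)
    rwa [zero_mul] at this
  · exact (hsum.trans_lt (ENNReal.mul_lt_top hD2.lt_top hx.2)).ne
  · gcongr
    rw [← ENNReal.ofReal_toReal hD2]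
    refine ENNReal.ofReal_le_ofReal ?_
    rw [ENNReal.ofReal_toReal hD2]
    linarith

end IsLorentzWeight

end

theorem corollaryc2 (φ : ℝ → ℝ) (hmono : MonotoneOn φ (Icc 0 1))
    (hconc : ConcaveOn ℝ (Icc 0 1) φ) (hzero : φ 0 = 0) (hpos : 0 < φ 1)
    (hlim : Tendsto φ (𝓝[>] 0) (𝓝 0)) :
    (∀ f : ℝ → ℝ, MemLorentz hmono f → (∫ t in (0 : ℝ)..1, f t) ≠ 0 →
        IsAbsolutelyRepresentingSystem hmono f) ↔
      IsSubmultiplicative φ := by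
  have h : IsLorentzWeight φ := ⟨hmono, hconc, hzero, hpos, hlim⟩
  exact ⟨h.isSubmultiplicative_of_representing, fun hφ _ hf hI =>
    h.representing_of_isSubmultiplicative hφ hf hI⟩
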